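/- Consider a two-player zero-sum stochastic game with finite non-empty sets of states $\mathcal S$, max-player actions $\mathcal A$ and min-player actions $\mathcal B$, of sizes $S,A,B$, with rewards $r(s,a,b)\in[0,1]$ and transition probabilities $P(\cdot\mid s,a,b)$. For Markovian policies $\mu:\mathcal S\to\Delta_{\mathcal A}$, $\nu:\mathcal S\to\Delta_{\mathcal B}$ let $T^{(\mu,\nu)}_{s\to s'}\in[0,\infty]$ be the expected time to go from $s$ to $s'$ ($0$ if $s=s'$), and let $J^{(\mu,\nu)}(s)=\lim_{T\to\infty}\frac1T\,\mathbb E_{(\mu,\nu)}\big[\sum_{t=1}^T r(s_t,a_t,b_t)\mid s_1=s\big]$. Let $D\ge 0$ be a real number, known to the learner, with $\sup_{s,s'}\sup_\nu\inf_\mu T^{(\mu,\nu)}_{s\to s'}\le D$. Then the game has a value: there is $J^*\in\mathbb R$ with $J^*=\max_\mu\min_\nu J^{(\mu,\nu)}(s)=\min_\nu\max_\mu J^{(\mu,\nu)}(s)$ for every state $s$. The learner controls the max-player and runs DONQ-learning with horizon $T$ and parameters $H>1$, $\delta\in(0,1)$. Put $\gamma=1-\frac1H$, $\alpha_\tau=\frac{H+1}{H+\tau}$,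 $\beta_\tau=2D\sqrt{H\log(2T/\delta)/\tau}$. Initially $\overline Q_1=\overline Q_1^{\downarrow}=H$, $\overline V_1^{\downarrow}=H$, $N_1=0$ and $\mu_1(\cdot\mid s)$ is uniform. For $t=1,\dots,T$: in the current state $s_t$ the learner draws $a_t\sim\mu_t(\cdot\mid s_t)$ while the opponent simultaneously and independently draws $b_t$ from an arbitrary distribution depending on all past states and actions and on $s_t$; then $s_{t+1}\sim P(\cdot\mid s_t,a_t,b_t)$. With $\tau=N_{t+1}(s_t,a_t,b_t)=N_t(s_t,a_t,b_t)+1$ the learner sets $$\overline Q_{t+1}(s_t,a_t,b_t)=(1-\alpha_\tau)\overline Q_t(s_t,a_t,b_t)+\alpha_\tau\big[r(s_t,a_t,b_t)+\gamma\overline V_t^{\downarrow}(s_{t+1})+\beta_\tau\big],$$ $$\overline Q^{\downarrow}_{t+1}(s_t,a_t,b_t)=\min\big(\overline Q^{\downarrow}_t(s_t,a_t,b_t),\overline Q_{t+1}(s_t,a_t,b_t)\big),$$ takes for $(\mu_{t+1}(\cdot\mid s_t),\tilde\nu_{t+1}(\cdot\mid s_t))$ a Nash equilibrium of the matrix game $\overline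 Q^{\downarrow}_{t+1}(s_t,\cdot,\cdot)$ (returned by any fixed procedure that solves matrix games), lets $\overline V^{\downarrow}_{t+1}(s_t)$ be the expectation of $\overline Q^{\downarrow}_{t+1}(s_t,a,b)$ under this equilibrium, and leaves all other entries unchanged. The regret is $\mathrm{Reg}(T)=\sum_{t=1}^T\big(J^*-r(s_t,a_t,b_t)\big)$. Take $\delta=1/T$ and $H=\Big(\frac{T}{SAB\log(2T^2)}\Big)^{1/3}$. Then for $T$ sufficiently large, and for every initial state, opponent and matrix-game solver, $$\mathbb E[\mathrm{Reg}(T)]\le 13\,D\,(SAB\log(2T^2))^{1/3}\,T^{2/3}+o\big(T^{2/3}\big),$$ where the threshold on $T$ and the $o(T^{2/3})$ term depend only on $S,A,B,D$ (not on the game, opponent, initial state or solver). In particular this bound is $o(T)$: the expected regret is sublinear. -/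

import Mathlib

open scoped ENNReal

noncomputable section

namespace DONQ

/-- The set of probability distributions on a finite set `X`. -/
abbrev Dist (X : Type*) [Fintype X] : Type _ := {p : X → ℝ // p ∈ stdSimplex ℝ X}

/-- A distribution on a finite set, as a `PMF`. -/
def Dist.toPMF {X : Type*} [Fintype X] (p : Dist X) : PMF X :=
  PMF.ofFintype (fun x => ENNReal.ofReal (p.1 x)) (by
    rw [← ENNReal.ofReal_sum_of_nonneg (fun x _ => p.2.1 x), p.2.2, ENNReal.ofReal_one])

/-- The uniform distribution on a finite non-empty set. -/
def Dist.uniform (X : Type*) [Fintype X] [Nonempty X] : Dist X :=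
  ⟨fun _ => 1 / (Fintype.card X : ℝ), fun _ => by positivity, by simp⟩

section Games

variable {S A B : Type*} [Fintype S] [Fintype A] [Fintype B]

/-- The expectation of `M a b` when `a ∼ p` and `b ∼ q` are drawn independently. -/
def mix (p : Dist A) (q : Dist B) (M : A → B → ℝ) : ℝ :=
  ∑ a, ∑ b, p.1 a * q.1 b * M a b

/-- `(p, q)` is a Nash equilibrium of the zero-sum matrix game `M`, in which the first player
maximizes and the second player minimizes. -/
def IsNash (M : A → B → ℝ) (p : Dist A) (q : Dist B) : Prop :=
  (∀ p' : Dist A, mix p' q M ≤ mix p q M) ∧ ∀ q' : Dist B, mix p q M ≤ mix p q' M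

/-- A procedure that returns a Nash equilibrium of every matrix game. -/
def IsNashSolver (nash : (A → B → ℝ) → Dist A × Dist B) : Prop :=
  ∀ M, IsNash M (nash M).1 (nash M).2

/-- A two-player zero-sum simultaneous stochastic game with states `S`, max-player's actions `A`,
min-player's actions `B`, rewards in `[0, 1]` and transition probabilities `P s a b`. -/
structure Game (S A B : Type*) [Fintype S] where
  r : S → A → B → ℝ
  r_mem : ∀ s a b, r s a b ∈ Set.Icc (0 : ℝ) 1
  P : S → A → B → Dist S

namespace Game

variable (G : Game S A B)

/-- The expected one-step reward under a pair of Markovian policies. -/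
def reward (μ : S → Dist A) (ν : S → Dist B) (s : S) : ℝ :=
  mix (μ s) (ν s) (G.r s)

/-- The transition matrix of the Markov chain of states under a pair of Markovian policies. -/
def trans (μ : S → Dist A) (ν : S → Dist B) : Matrix S S ℝ :=
  Matrix.of fun s s' => mix (μ s) (ν s) (fun a b => (G.P s a b).1 s')

/-- The average reward: the limit of `(1/T) 𝔼[∑_{t=1}^T r(s_t) | s_1 = s]`, where
`𝔼[r(s_{t+1}) | s_1 = s]` is `(P^t r)(s)` for the transition matrix `P` of the chain.
The limit exists, because the chain is finite. -/
def avgReward [DecidableEq S] (μ : S → Dist A) (ν : S → Dist B) (s : S) : ℝ :=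
  Filter.limUnder Filter.atTop fun T : ℕ =>
    (1 / (T : ℝ)) * ∑ t ∈ Finset.range T, ((G.trans μ ν ^ t).mulVec (G.reward μ ν)) s

/-- `J` is the value of the average-reward game: from every initial state, both the max-min and
the min-max over Markovian policies of the average reward are equal to `J`. -/
def IsValue [DecidableEq S] (J : ℝ) : Prop :=
  ∀ s : S,
    (⨆ μ : S → Dist A, ⨅ ν : S → Dist B, G.avgReward μ ν s) = J ∧
    (⨅ ν : S → Dist B, ⨆ μ : S → Dist A, G.avgReward μ ν s) = J

/-- `G.avoid μ ν g n s` is the probability that the chain of states under `(μ, ν)`, started in `s`,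
is not in `g` at any of the times `0, …, n`. -/
def avoid [DecidableEq S] (μ : S → Dist A) (ν : S → Dist B) (g : S) : ℕ → S → ℝ
  | 0, s => if s = g then 0 else 1
  | n + 1, s => if s = g then 0 else ∑ s', G.trans μ ν s s' * avoid μ ν g n s'

/-- The expected time `𝔼[τ] = ∑_{n ≥ 0} ℙ(τ > n)` that the chain under `(μ, ν)` takes to go from
`s` to `g` (it is `0` for `s = g`, and `∞` where the sum diverges). -/
def hittingTime [DecidableEq S] (μ : S → Dist A) (ν : S → Dist B) (s g : S) : ℝ≥0∞ :=
  ∑' n, ENNReal.ofReal (G.avoid μ ν g n s)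

/-- The diameter of the game: the worst case, over pairs of states and Markovian policies of the
min-player, of the least expected travel time that the max-player can achieve in response. -/
def diameter [DecidableEq S] : ℝ≥0∞ :=
  ⨆ (s : S) (g : S) (ν : S → Dist B), ⨅ μ : S → Dist A, G.hittingTime μ ν s g

end Game

/-- The memory of the learner: the estimators `Q`, `Q↓`, `V↓`, the visit counts and the current
Markovian policy. -/
structure Memory (S A B : Type*) [Fintype A] where
  Q : S → A → B → ℝ
  Qdown : S → A → B → ℝ
  Vdown : S → ℝ
  N : S → A → B → ℕ
  μ : S → Dist A

/-- The initial memory. -/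
def Memory.init (S A B : Type*) [Fintype A] [Nonempty A] (H : ℝ) : Memory S A B where
  Q := fun _ _ _ => H
  Qdown := fun _ _ _ => H
  Vdown := fun _ => H
  N := fun _ _ _ => 0
  μ := fun _ => Dist.uniform A

/-- The learning rate `α_τ`. -/
def learningRate (H : ℝ) (τ : ℕ) : ℝ := (H + 1) / (H + τ)

/-- The bonus `β_τ`, for the horizon `T` and the confidence level `δ`. -/
def bonus (D H δ : ℝ) (T τ : ℕ) : ℝ :=
  2 * D * Real.sqrt (H * Real.log (2 * T / δ) / τ)

/-- One update of the memory by DONQ-learning: in state `s` the actions `a`, `b` were played, the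
reward `x` was received and the next state is `s'`. The discount factor is `1 - 1 / H`. -/
def Memory.update [DecidableEq S] [DecidableEq A] [DecidableEq B]
    (nash : (A → B → ℝ) → Dist A × Dist B) (D H δ : ℝ) (T : ℕ)
    (m : Memory S A B) (s : S) (a : A) (b : B) (x : ℝ) (s' : S) : Memory S A B :=
  let τ : ℕ := m.N s a b + 1
  let α : ℝ := learningRate H τ
  let q : ℝ := (1 - α) * m.Q s a b
    + α * (x + (1 - 1 / H) * m.Vdown s' + bonus D H δ T τ)
  let qdown : ℝ := min (m.Qdown s a b) q
  let Qdown' : S → A → B → ℝ := fun i j k =>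
    if i = s ∧ j = a ∧ k = b then qdown else m.Qdown i j k
  let π : Dist A × Dist B := nash (Qdown' s)
  { Q := fun i j k => if i = s ∧ j = a ∧ k = b then q else m.Q i j k
    Qdown := Qdown'
    Vdown := fun i => if i = s then mix π.1 π.2 (Qdown' s) else m.Vdown i
    N := fun i j k => if i = s ∧ j = a ∧ k = b then τ else m.N i j k
    μ := fun i => if i = s then π.1 else m.μ i }

/-- A strategy of the opponent: the distribution of the next action, given the list of all
previous rounds (state and both actions, the latest round first) and the current state. -/
abbrev Opponent (S A B : Type*) [Fintype B] : Type _ := List (S × A × B) → S → Dist B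

/-- A stage of the interaction: the previous rounds (latest first), the current state and the
memory of the learner. -/
structure Stage (S A B : Type*) [Fintype A] where
  rounds : List (S × A × B)
  state : S
  memory : Memory S A B

/-- The law of the stage that is reached after `t` rounds, when DONQ-learning (with its
parameters) plays `G` from the state `s₁` against the opponent `opp`. -/
def law [DecidableEq S] [DecidableEq A] [DecidableEq B] [Nonempty A]
    (G : Game S A B) (nash : (A → B → ℝ) → Dist A × Dist B) (D H δ : ℝ) (T : ℕ)
    (opp : Opponent S A B) (s₁ : S) : ℕ → PMF (Stage S A B)
  | 0 => PMF.pure ⟨[], s₁, Memory.init S A B H⟩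
  | t + 1 =>
    (law G nash D H δ T opp s₁ t).bind fun g =>
      (g.memory.μ g.state).toPMF.bind fun a =>
        (opp g.rounds g.state).toPMF.bind fun b =>
          (G.P g.state a b).toPMF.bind fun s' =>
            PMF.pure
              ⟨(g.state, a, b) :: g.rounds, s',
                g.memory.update nash D H δ T g.state a b (G.r g.state a b) s'⟩

/-- The regret of a list of rounds, with respect to the average reward `J`. -/
def regret (G : Game S A B) (J : ℝ) (rounds : List (S × A × B)) : ℝ :=
  (rounds.map fun z => J - G.r z.1 z.2.1 z.2.2).sum

/-- The expected regret of DONQ-learning after `T` rounds (the law has finite support). -/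
def expectedRegret [DecidableEq S] [DecidableEq A] [DecidableEq B] [Nonempty A]
    (G : Game S A B) (J : ℝ) (nash : (A → B → ℝ) → Dist A × Dist B) (D H δ : ℝ) (T : ℕ)
    (opp : Opponent S A B) (s₁ : S) : ℝ :=
  ∑' g : Stage S A B, (law G nash D H δ T opp s₁ T g).toReal * regret G J g.rounds

end Games

end DONQ

end

/-! Discounted values differ between states by at most `D`: against the minimizer's optimal
discounted policy, the maximizer can travel from any state to the best one in expected time at most
`D + ε`, losing at most one unit per step. As the discount factor tends to 1, compactness yields `J
+ h = val (r + P h)` with `-D ≤ h ≤ 0` (`exists_optimality`). Telescoping `h - P h` along the chain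
shows that `J` is the value of the game.

The learner's estimates are compared with `w = H J + h` instead of the discounted value. As `h ≤ 0`,
`w ≤ val (r + γ P w)`, so estimators above `c = r + γ P w` keep the state values above `w`. The
noise in this comparison comes from `h` alone, is centred and bounded by `D`, and a bonus
proportional to `D` beats it. Each entry carries an exponential potential (`exists_potential`).
Their sum grows by at most one per round in expectation and is at least `exp l`, `l = log (2T/δ)`,
when optimism first fails. So failure has probability at most `T exp (-l)`.

Under optimism, a second potential, which contains the regret, does not grow in expectation
(`step_potential_le`). Weighting an entry visited `k` times by `1 + k/H` makes its recursion
additive. The remaining drift is `V(s) - Q(s,a,b)`, of non-positive mean since the learner plays a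
maximin strategy, plus `J - D/H - P w/H ≤ 0`. This leaves the discounting cost `T D/H`, the bonuses,
of order `D √(H l SAB T)`, and boundary terms of order `H`. For the prescribed `H` the first two
give coefficients 1 and at most 8, within 13. -/

noncomputable section

namespace DONQ

/-! ### Matrix games: the minimax theorem and the value as a 1-Lipschitz function. -/

section Mix

variable {S A B : Type*} [Fintype S] [Fintype A] [Fintype B]

theorem mix_add (p : Dist A) (q : Dist B) (M N : A → B → ℝ) :
    mix p q (fun a b => M a b + N a b) = mix p q M + mix p q N := by
  simp only [mix, mul_add, Finset.sum_add_distrib]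

theorem mix_sub (p : Dist A) (q : Dist B) (M N : A → B → ℝ) :
    mix p q (fun a b => M a b - N a b) = mix p q M - mix p q N := by
  simp only [mix, mul_sub, Finset.sum_sub_distrib]

theorem mix_mul_left (p : Dist A) (q : Dist B) (c : ℝ) (M : A → B → ℝ) :
    mix p q (fun a b => c * M a b) = c * mix p q M := by
  simp only [mix, Finset.mul_sum]
  exact Finset.sum_congr rfl fun a _ => Finset.sum_congr rfl fun b _ => by ring

theorem mix_const (p : Dist A) (q : Dist B) (c : ℝ) : mix p q (fun _ _ => c) = c := by
  simp only [mix, ← Finset.sum_mul, ← Finset.mul_sum, q.2.2, mul_one, p.2.2, one_mul]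

theorem mix_mono (p : Dist A) (q : Dist B) {M N : A → B → ℝ} (h : ∀ a b, M a b ≤ N a b) :
    mix p q M ≤ mix p q N :=
  Finset.sum_le_sum fun a _ => Finset.sum_le_sum fun b _ =>
    mul_le_mul_of_nonneg_left (h a b) (mul_nonneg (p.2.1 a) (q.2.1 b))

theorem mix_sum {ι : Type*} (t : Finset ι) (p : Dist A) (q : Dist B) (M : ι → A → B → ℝ) :
    mix p q (fun a b => ∑ i ∈ t, M i a b) = ∑ i ∈ t, mix p q (M i) := by
  classical
  induction t using Finset.induction_on with
  | empty => simp [mix]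
  | insert i t hi ih => simp only [Finset.sum_insert hi, mix_add, ih]

theorem le_mix (p : Dist A) (q : Dist B) {M : A → B → ℝ} {c : ℝ} (h : ∀ a b, c ≤ M a b) :
    c ≤ mix p q M :=
  (mix_const p q c).symm.trans_le (mix_mono p q h)

theorem mix_le (p : Dist A) (q : Dist B) {M : A → B → ℝ} {c : ℝ} (h : ∀ a b, M a b ≤ c) :
    mix p q M ≤ c :=
  (mix_mono p q h).trans_eq (mix_const p q c)

/-- Equilibrium values are monotone in the matrix, up to a constant. -/
theorem IsNash.mix_le_mix_add {M M' : A → B → ℝ} {p p' : Dist A} {q q' : Dist B}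
    (h : IsNash M p q) (h' : IsNash M' p' q') {c : ℝ} (hM : ∀ a b, M a b ≤ M' a b + c) :
    mix p q M ≤ mix p' q' M' + c :=
  calc mix p q M ≤ mix p q' M := h.2 q'
    _ ≤ mix p q' (fun a b => M' a b + c) := mix_mono _ _ hM
    _ = mix p q' M' + c := by rw [mix_add p q' M' (fun _ _ => c), mix_const]
    _ ≤ mix p' q' M' + c := by linarith [h'.1 p]

theorem IsNash.mix_le_mix {M M' : A → B → ℝ} {p p' : Dist A} {q q' : Dist B}
    (h : IsNash M p q) (h' : IsNash M' p' q') (hM : ∀ a b, M a b ≤ M' a b) :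
    mix p q M ≤ mix p' q' M' := by
  simpa using h.mix_le_mix_add h' (c := 0) (by simpa using hM)

/-- The minimax theorem for matrix games. -/
theorem exists_isNash [Nonempty A] [Nonempty B] (M : A → B → ℝ) :
    ∃ p : Dist A, ∃ q : Dist B, IsNash M p q := by
  classical
  let F : (B → ℝ) →ₗ[ℝ] (A → ℝ) →ₗ[ℝ] ℝ :=
    LinearMap.mk₂ ℝ (fun q p => ∑ a, ∑ b, p a * q b * M a b)
      (fun q q' p => by
        simp only [Pi.add_apply, mul_add, add_mul, Finset.sum_add_distrib])
      (fun c q p => by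
        simp only [Pi.smul_apply, smul_eq_mul, Finset.mul_sum]
        exact Finset.sum_congr rfl fun a _ => Finset.sum_congr rfl fun b _ => by ring)
      (fun q p p' => by
        simp only [Pi.add_apply, add_mul, Finset.sum_add_distrib])
      (fun c q p => by
        simp only [Pi.smul_apply, smul_eq_mul, Finset.mul_sum]
        exact Finset.sum_congr rfl fun a _ => Finset.sum_congr rfl fun b _ => by ring)
  obtain ⟨q, hq, p, hp, h⟩ := Sion.exists_isSaddlePointOn (X := stdSimplex ℝ B)
    (Y := stdSimplex ℝ A) (f := fun q p => F q p)
    (⟨_, (Dist.uniform B).2⟩) (convex_stdSimplex ℝ B) (isCompact_stdSimplex ℝ B)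
    (fun p _ => ((F.flip p).continuous_of_finiteDimensional.lowerSemicontinuous).lowerSemicontinuousOn _)
    (fun p _ => ((F.flip p).convexOn (convex_stdSimplex ℝ B)).quasiconvexOn)
    (convex_stdSimplex ℝ A) (⟨_, (Dist.uniform A).2⟩) (isCompact_stdSimplex ℝ A)
    (fun q _ => ((F q).continuous_of_finiteDimensional.upperSemicontinuous).upperSemicontinuousOn _)
    (fun q _ => ((F q).concaveOn (convex_stdSimplex ℝ A)).quasiconcaveOn)
  exact ⟨⟨p, hp⟩, ⟨q, hq⟩, fun p' => h q hq p'.1 p'.2, fun q' => h q'.1 q'.2 p hp⟩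

/-- A Nash equilibrium of a matrix game. -/
def saddle [Nonempty A] [Nonempty B] (M : A → B → ℝ) : Dist A × Dist B :=
  ((exists_isNash M).choose, (exists_isNash M).choose_spec.choose)

theorem isNashSolver_saddle [Nonempty A] [Nonempty B] :
    IsNashSolver (saddle : (A → B → ℝ) → Dist A × Dist B) :=
  fun M => (exists_isNash M).choose_spec.choose_spec

/-- The value of a matrix game. -/
def matrixValue [Nonempty A] [Nonempty B] (M : A → B → ℝ) : ℝ :=
  mix (saddle M).1 (saddle M).2 M

theorem matrixValue_le_add [Nonempty A] [Nonempty B] {M M' : A → B → ℝ} {c : ℝ}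
    (h : ∀ a b, M a b ≤ M' a b + c) : matrixValue M ≤ matrixValue M' + c :=
  (isNashSolver_saddle M).mix_le_mix_add (isNashSolver_saddle M') h

theorem abs_matrixValue_sub_le [Nonempty A] [Nonempty B] {M M' : A → B → ℝ} {c : ℝ}
    (h : ∀ a b, |M a b - M' a b| ≤ c) : |matrixValue M - matrixValue M'| ≤ c := by
  rw [abs_sub_le_iff]
  constructor
  · have := matrixValue_le_add (M := M) (M' := M') (c := c) fun a b => by
      linarith [(abs_sub_le_iff.1 (h a b)).1]
    linarith
  · have := matrixValue_le_add (M := M') (M' := M) (c := c) fun a b => by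
      linarith [(abs_sub_le_iff.1 (h a b)).2]
    linarith

theorem matrixValue_add_const [Nonempty A] [Nonempty B] (M : A → B → ℝ) (c : ℝ) :
    matrixValue (fun a b => M a b + c) = matrixValue M + c := by
  apply le_antisymm
  · exact matrixValue_le_add fun a b => le_rfl
  · have := matrixValue_le_add (M := M) (M' := fun a b => M a b + c) (c := -c) fun a b => by simp
    linarith

end Mix

/-! ### One-step expectations and the discounted game. -/

namespace Game

section Expect

variable {S A B : Type*} [Fintype S] (G : Game S A B)

/-- The expectation of `v` at the next state. -/
def expect (v : S → ℝ) (s : S) (a : A) (b : B) : ℝ := ∑ s', (G.P s a b).1 s' * v s'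

theorem expect_mono {v w : S → ℝ} (h : ∀ s, v s ≤ w s) (s : S) (a : A) (b : B) :
    G.expect v s a b ≤ G.expect w s a b :=
  Finset.sum_le_sum fun s' _ => mul_le_mul_of_nonneg_left (h s') ((G.P s a b).2.1 s')

theorem expect_const (c : ℝ) (s : S) (a : A) (b : B) : G.expect (fun _ => c) s a b = c := by
  rw [expect, ← Finset.sum_mul, (G.P s a b).2.2, one_mul]

theorem expect_add (v w : S → ℝ) (s : S) (a : A) (b : B) :
    G.expect (fun x => v x + w x) s a b = G.expect v s a b + G.expect w s a b := by
  simp only [expect, mul_add, Finset.sum_add_distrib]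

theorem expect_sub (v w : S → ℝ) (s : S) (a : A) (b : B) :
    G.expect (fun x => v x - w x) s a b = G.expect v s a b - G.expect w s a b := by
  simp only [expect, mul_sub, Finset.sum_sub_distrib]

theorem expect_mul_left (c : ℝ) (v : S → ℝ) (s : S) (a : A) (b : B) :
    G.expect (fun x => c * v x) s a b = c * G.expect v s a b := by
  simp only [expect, Finset.mul_sum]
  exact Finset.sum_congr rfl fun x _ => by ring

theorem le_expect {v : S → ℝ} {c : ℝ} (h : ∀ s, c ≤ v s) (s : S) (a : A) (b : B) :
    c ≤ G.expect v s a b :=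
  (G.expect_const c s a b).symm.trans_le (G.expect_mono h s a b)

theorem expect_le {v : S → ℝ} {c : ℝ} (h : ∀ s, v s ≤ c) (s : S) (a : A) (b : B) :
    G.expect v s a b ≤ c :=
  (G.expect_mono h s a b).trans_eq (G.expect_const c s a b)

end Expect

variable {S A B : Type*} [Fintype S] [Fintype A] [Fintype B] (G : Game S A B)

theorem sum_trans_mul (μ : S → Dist A) (ν : S → Dist B) (v : S → ℝ) (s : S) :
    ∑ s', G.trans μ ν s s' * v s' = mix (μ s) (ν s) (G.expect v s) := by
  simp only [trans, Matrix.of_apply]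
  rw [show G.expect v s = fun a b => ∑ s', v s' * (G.P s a b).1 s' from by
    funext a b; simp only [expect, mul_comm], mix_sum]
  exact Finset.sum_congr rfl fun s' _ => by rw [mix_mul_left, mul_comm]

/-- The discounted Shapley operator. -/
def shapley [Nonempty A] [Nonempty B] (γ : ℝ) (v : S → ℝ) (s : S) : ℝ :=
  matrixValue fun a b => G.r s a b + γ * G.expect v s a b

theorem exists_shapley_fixedPoint [Nonempty A] [Nonempty B] {γ : ℝ} (h0 : 0 ≤ γ) (h1 : γ < 1) :
    ∃ v : S → ℝ, G.shapley γ v = v := by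
  have hc : ContractingWith ⟨γ, h0⟩ (G.shapley γ) := by
    refine ⟨h1, LipschitzWith.of_dist_le_mul fun v w => ?_⟩
    rw [dist_pi_le_iff (by positivity)]
    intro s
    rw [Real.dist_eq]
    refine abs_matrixValue_sub_le fun a b => ?_
    have h : ∀ x, |v x - w x| ≤ dist v w := fun x => by
      rw [← Real.dist_eq]; exact dist_le_pi_dist v w x
    have h2 : |G.expect v s a b - G.expect w s a b| ≤ dist v w := by
      rw [← expect_sub, abs_le]
      exact ⟨G.le_expect (fun x => (abs_le.1 (h x)).1) s a b,
        G.expect_le (fun x => (abs_le.1 (h x)).2) s a b⟩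
    calc _ = |γ * (G.expect v s a b - G.expect w s a b)| := by congr 1; ring
      _ = γ * |G.expect v s a b - G.expect w s a b| := by rw [abs_mul, abs_of_nonneg h0]
      _ ≤ γ * dist v w := mul_le_mul_of_nonneg_left h2 h0
  exact ⟨_, hc.fixedPoint_isFixedPt⟩

end Game

/-! ### Cesàro averages of powers of a stochastic matrix. -/

section Cesaro

open Filter Topology

variable {S : Type*} [Fintype S]

theorem mulVec_le_mulVec {P : Matrix S S ℝ} (h0 : ∀ s s', 0 ≤ P s s') {x y : S → ℝ}
    (h : ∀ s, x s ≤ y s) (s : S) : P.mulVec x s ≤ P.mulVec y s :=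
  Finset.sum_le_sum fun s' _ => mul_le_mul_of_nonneg_left (h s') (h0 s s')

theorem exists_abs_le (x : S → ℝ) : ∃ c, ∀ s, |x s| ≤ c :=
  ⟨‖x‖, fun s => norm_le_pi_norm x s⟩

variable [DecidableEq S]

/-- The sum telescopes; the right side stays bounded in `T`, so averages of `y - P y` vanish in the
limit. -/
theorem sum_pow_mulVec_sub (P : Matrix S S ℝ) (y : S → ℝ) (T : ℕ) :
    ∑ t ∈ Finset.range T, (P ^ t).mulVec (y - P.mulVec y) = y - (P ^ T).mulVec y := by
  induction T with
  | zero => simp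
  | succ T ih =>
    rw [Finset.sum_range_succ, ih, Matrix.mulVec_sub, Matrix.mulVec_mulVec, ← pow_succ]
    abel

theorem pow_mulVec_const {P : Matrix S S ℝ} (h1 : ∀ s, ∑ s', P s s' = 1) (c : ℝ) (t : ℕ) :
    (P ^ t).mulVec (fun _ => c) = fun _ => c := by
  induction t with
  | zero => simp
  | succ t ih =>
    rw [pow_succ, ← Matrix.mulVec_mulVec]
    rw [show P.mulVec (fun _ => c) = fun _ => c from
      funext fun s => by simp [Matrix.mulVec, dotProduct, ← Finset.sum_mul, h1], ih]

theorem pow_mulVec_le_pow_mulVec {P : Matrix S S ℝ} (h0 : ∀ s s', 0 ≤ P s s') {x y : S → ℝ}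
    (h : ∀ s, x s ≤ y s) (t : ℕ) (s : S) : (P ^ t).mulVec x s ≤ (P ^ t).mulVec y s := by
  induction t generalizing s with
  | zero => simpa using h s
  | succ t ih =>
    rw [pow_succ', ← Matrix.mulVec_mulVec, ← Matrix.mulVec_mulVec]
    exact mulVec_le_mulVec h0 ih s

theorem abs_pow_mulVec_le {P : Matrix S S ℝ} (h0 : ∀ s s', 0 ≤ P s s')
    (h1 : ∀ s, ∑ s', P s s' = 1) {x : S → ℝ} {c : ℝ} (h : ∀ s, |x s| ≤ c) (t : ℕ) (s : S) :
    |(P ^ t).mulVec x s| ≤ c := by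
  rw [abs_le]
  have hu := pow_mulVec_le_pow_mulVec h0 (fun s => (abs_le.1 (h s)).2) t s
  have hl := pow_mulVec_le_pow_mulVec h0 (fun s => (abs_le.1 (h s)).1) t s
  rw [pow_mulVec_const h1] at hu hl
  exact ⟨hl, hu⟩

theorem tendsto_one_div_mul_of_abs_le {u : ℕ → ℝ} {c : ℝ} (h : ∀ n, |u n| ≤ c) :
    Tendsto (fun n : ℕ => 1 / (n : ℝ) * u n) atTop (𝓝 0) := by
  refine squeeze_zero_norm (a := fun n : ℕ => c / (n : ℝ)) (fun n => ?_)
    (tendsto_const_div_atTop_nhds_zero_nat c)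
  rw [Real.norm_eq_abs, abs_mul, abs_of_nonneg (by positivity), one_div, inv_mul_eq_div]
  gcongr
  exact h n

/-- The mean ergodic theorem for finite stochastic matrices. -/
theorem exists_tendsto_average {P : Matrix S S ℝ} (h0 : ∀ s s', 0 ≤ P s s')
    (h1 : ∀ s, ∑ s', P s s' = 1) (x : S → ℝ) (s : S) :
    ∃ l : ℝ, Tendsto (fun T : ℕ => 1 / (T : ℝ) * ∑ t ∈ Finset.range T, (P ^ t).mulVec x s)
      atTop (𝓝 l) := by
  set f : Module.End ℝ (S → ℝ) := Matrix.toLin' (1 - P) with hf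
  have hfx : ∀ y, f y = y - P.mulVec y := fun y => by
    rw [hf, Matrix.toLin'_apply, Matrix.sub_mulVec, Matrix.one_mulVec]
  -- A vector `z = y - P y` fixed by `P` satisfies `n z = y - P ^ n y`, which is bounded in `n`, so
  -- `z = 0`. Hence all powers of `1 - P` have the same kernel.
  have hker : ∀ y, f (f y) = 0 → f y = 0 := by
    intro y hy
    set z := f y with hz
    have hPz : ∀ t : ℕ, (P ^ t).mulVec z = z := by
      have hP : P.mulVec z = z := (sub_eq_zero.1 ((hfx z).symm.trans hy)).symm
      intro t
      induction t with
      | zero => simp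
      | succ t ih => rw [pow_succ, ← Matrix.mulVec_mulVec, hP, ih]
    obtain ⟨c, hc⟩ := exists_abs_le y
    funext s
    have hlim : Tendsto (fun n : ℕ => 1 / (n : ℝ) * (y s - (P ^ n).mulVec y s)) atTop (𝓝 0) := by
      refine tendsto_one_div_mul_of_abs_le (c := c + c) fun n => ?_
      exact (abs_sub _ _).trans (add_le_add (hc s) (abs_pow_mulVec_le h0 h1 hc n s))
    refine tendsto_nhds_unique (tendsto_const_nhds.congr' ?_) hlim
    filter_upwards [eventually_gt_atTop 0] with n hn
    have h := congrFun (sum_pow_mulVec_sub P y n) s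
    rw [← hfx, ← hz] at h
    simp only [hPz, Finset.sum_const, Finset.card_range, Pi.smul_apply, Pi.sub_apply,
      nsmul_eq_mul] at h
    rw [← h]
    field_simp
  have hkern : ∀ n y, (f ^ n) y = 0 → f y = 0 := by
    intro n
    induction n with
    | zero => intro y hy; rw [show y = 0 by simpa using hy, map_zero]
    | succ n ih =>
      intro y hy
      refine hker y (ih _ ?_)
      rwa [pow_succ] at hy
  -- Fitting decomposition of `1 - P`: the kernel part is fixed by `P` and is the limit; the range
  -- part has the form `z - P z`, as `n > 0`, and averages to zero.
  obtain ⟨n, hn, hn1⟩ :=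
    (f.eventually_isCompl_ker_pow_range_pow.and (eventually_gt_atTop 0)).exists
  obtain ⟨k, hk, z, hz, rfl⟩ := Submodule.mem_sup.1
    (show x ∈ LinearMap.ker (f ^ n) ⊔ LinearMap.range (f ^ n) by
      rw [hn.sup_eq_top]; trivial)
  obtain ⟨y, rfl⟩ := LinearMap.mem_range.1 hz
  have hk' : ∀ t : ℕ, (P ^ t).mulVec k = k := by
    have hP : P.mulVec k = k :=
      (sub_eq_zero.1 ((hfx k).symm.trans (hkern n k (LinearMap.mem_ker.1 hk)))).symm
    intro t
    induction t with
    | zero => simp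
    | succ t ih => rw [pow_succ, ← Matrix.mulVec_mulVec, hP, ih]
  obtain ⟨m, rfl⟩ := Nat.exists_eq_succ_of_ne_zero hn1.ne'
  rw [pow_succ', Module.End.mul_apply, hfx]
  set z := (f ^ m) y
  obtain ⟨c, hc⟩ := exists_abs_le z
  refine ⟨k s + 0, ?_⟩
  have hlim : Tendsto (fun n : ℕ => 1 / (n : ℝ) * (z s - (P ^ n).mulVec z s)) atTop (𝓝 0) :=
    tendsto_one_div_mul_of_abs_le (c := c + c) fun n =>
      (abs_sub _ _).trans (add_le_add (hc s) (abs_pow_mulVec_le h0 h1 hc n s))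
  refine (tendsto_const_nhds.add hlim).congr' ?_
  filter_upwards [eventually_gt_atTop 0] with T hT
  have h := congrFun (sum_pow_mulVec_sub P z T) s
  simp only [Finset.sum_apply, Pi.sub_apply] at h
  simp only [Matrix.mulVec_add, hk', Pi.add_apply, Finset.sum_add_distrib, Finset.sum_const,
    Finset.card_range, nsmul_eq_mul, h]
  field_simp

end Cesaro

/-! ### Average reward, and the value from the optimality equation. -/

namespace Game

open Filter Topology

variable {S A B : Type*} [Fintype S] [Fintype A] [Fintype B] (G : Game S A B)

theorem trans_nonneg (μ : S → Dist A) (ν : S → Dist B) (s s' : S) : 0 ≤ G.trans μ ν s s' :=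
  le_mix _ _ fun a b => (G.P s a b).2.1 s'

theorem sum_trans (μ : S → Dist A) (ν : S → Dist B) (s : S) : ∑ s', G.trans μ ν s s' = 1 := by
  have h := G.sum_trans_mul μ ν (fun _ => 1) s
  rw [show G.expect (fun _ => 1) s = fun _ _ => (1 : ℝ) from
    funext₂ fun a b => G.expect_const 1 s a b, mix_const] at h
  simpa using h

theorem mulVec_trans (μ : S → Dist A) (ν : S → Dist B) (v : S → ℝ) (s : S) :
    (G.trans μ ν).mulVec v s = mix (μ s) (ν s) (G.expect v s) :=
  G.sum_trans_mul μ ν v s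

section Average

variable [DecidableEq S]

theorem tendsto_avgReward (μ : S → Dist A) (ν : S → Dist B) (s : S) :
    Tendsto (fun T : ℕ => (1 / (T : ℝ)) *
      ∑ t ∈ Finset.range T, ((G.trans μ ν ^ t).mulVec (G.reward μ ν)) s)
      atTop (𝓝 (G.avgReward μ ν s)) :=
  tendsto_nhds_limUnder
    (exists_tendsto_average (G.trans_nonneg μ ν) (G.sum_trans μ ν) (G.reward μ ν) s)

/-- The corrections `h - P h` telescope to a bounded quantity. Comparing the reward with `J + h - P
h` pointwise then bounds the average reward by `J` from either side. -/
theorem tendsto_average_potential (μ : S → Dist A) (ν : S → Dist B) (J : ℝ) (h : S → ℝ) (s : S) :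
    Tendsto (fun T : ℕ => (1 / (T : ℝ)) * ∑ t ∈ Finset.range T,
      ((G.trans μ ν ^ t).mulVec ((fun _ => J) + (h - (G.trans μ ν).mulVec h))) s)
      atTop (𝓝 J) := by
  obtain ⟨c, hc⟩ := exists_abs_le h
  have hlim : Tendsto (fun n : ℕ => 1 / (n : ℝ) * (h s - (G.trans μ ν ^ n).mulVec h s))
      atTop (𝓝 0) :=
    tendsto_one_div_mul_of_abs_le (c := c + c) fun n => (abs_sub _ _).trans
      (add_le_add (hc s) (abs_pow_mulVec_le (G.trans_nonneg μ ν) (G.sum_trans μ ν) hc n s))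
  rw [← add_zero J]
  refine (tendsto_const_nhds.add hlim).congr' ?_
  filter_upwards [eventually_gt_atTop 0] with T hT
  have h' := congrFun (sum_pow_mulVec_sub (G.trans μ ν) h T) s
  simp only [Finset.sum_apply, Pi.sub_apply] at h'
  simp only [add_zero, Matrix.mulVec_add, Pi.add_apply, pow_mulVec_const (G.sum_trans μ ν),
    Finset.sum_add_distrib, Finset.sum_const, Finset.card_range, nsmul_eq_mul, h']
  field_simp

theorem le_avgReward {μ : S → Dist A} {ν : S → Dist B} {J : ℝ} {h : S → ℝ}
    (hJ : ∀ s, J + h s ≤ mix (μ s) (ν s) fun a b => G.r s a b + G.expect h s a b) (s : S) :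
    J ≤ G.avgReward μ ν s := by
  refine le_of_tendsto_of_tendsto' (G.tendsto_average_potential μ ν J h s)
    (G.tendsto_avgReward μ ν s) fun T => mul_le_mul_of_nonneg_left (Finset.sum_le_sum fun t _ =>
      pow_mulVec_le_pow_mulVec (G.trans_nonneg μ ν) (fun s => ?_) t s) (by positivity)
  have := hJ s
  rw [mix_add] at this
  simp only [Pi.add_apply, Pi.sub_apply, mulVec_trans, reward]
  linarith

theorem avgReward_le {μ : S → Dist A} {ν : S → Dist B} {J : ℝ} {h : S → ℝ}
    (hJ : ∀ s, (mix (μ s) (ν s) fun a b => G.r s a b + G.expect h s a b) ≤ J + h s) (s : S) :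
    G.avgReward μ ν s ≤ J := by
  refine le_of_tendsto_of_tendsto' (G.tendsto_avgReward μ ν s)
    (G.tendsto_average_potential μ ν J h s) fun T => mul_le_mul_of_nonneg_left
      (Finset.sum_le_sum fun t _ =>
      pow_mulVec_le_pow_mulVec (G.trans_nonneg μ ν) (fun s => ?_) t s) (by positivity)
  have := hJ s
  rw [mix_add] at this
  simp only [Pi.add_apply, Pi.sub_apply, mulVec_trans, reward]
  linarith

theorem avgReward_mem (μ : S → Dist A) (ν : S → Dist B) (s : S) :
    G.avgReward μ ν s ∈ Set.Icc (0 : ℝ) 1 := by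
  have h0 : G.expect (fun _ => 0) = fun _ _ _ => 0 := by
    funext s a b; exact G.expect_const 0 s a b
  constructor
  · refine G.le_avgReward (h := fun _ => 0) (fun s => le_mix _ _ fun a b => ?_) s
    simpa [h0] using (G.r_mem s a b).1
  · refine G.avgReward_le (h := fun _ => 0) (fun s => mix_le _ _ fun a b => ?_) s
    simpa [h0] using (G.r_mem s a b).2

/-- A solution of the average-reward optimality equation determines the value of the game. -/
theorem isValue_of_optimality [Nonempty A] [Nonempty B] {J : ℝ} {h : S → ℝ}
    (hJ : ∀ s, J + h s = matrixValue fun a b => G.r s a b + G.expect h s a b) :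
    G.IsValue J := by
  set M : S → A → B → ℝ := fun s a b => G.r s a b + G.expect h s a b with hM
  set μ' : S → Dist A := fun s => (saddle (M s)).1
  set ν' : S → Dist B := fun s => (saddle (M s)).2
  -- Statewise equilibria of the matrices `r + P h` give stationary policies that guarantee `J`
  -- against every stationary opponent.
  have hl : ∀ ν s, J ≤ G.avgReward μ' ν s := fun ν s =>
    G.le_avgReward (fun s => (hJ s).trans_le ((isNashSolver_saddle (M s)).2 (ν s))) s
  have hu : ∀ μ s, G.avgReward μ ν' s ≤ J := fun μ s =>
    G.avgReward_le (fun s => ((isNashSolver_saddle (M s)).1 (μ s)).trans_eq (hJ s).symm) s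
  have : Nonempty (Dist A) := ⟨Dist.uniform A⟩
  have : Nonempty (Dist B) := ⟨Dist.uniform B⟩
  intro s
  have hb : ∀ μ, BddBelow (Set.range fun ν => G.avgReward μ ν s) := fun μ =>
    ⟨0, by rintro _ ⟨ν, rfl⟩; exact (G.avgReward_mem μ ν s).1⟩
  have ha : ∀ ν, BddAbove (Set.range fun μ => G.avgReward μ ν s) := fun ν =>
    ⟨1, by rintro _ ⟨μ, rfl⟩; exact (G.avgReward_mem μ ν s).2⟩
  have h1 : ∀ μ, ⨅ ν, G.avgReward μ ν s ≤ J := fun μ => (ciInf_le (hb μ) ν').trans (hu μ s)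
  have h2 : ∀ ν, J ≤ ⨆ μ, G.avgReward μ ν s := fun ν => (hl ν s).trans (le_ciSup (ha ν) μ')
  constructor
  · refine le_antisymm (ciSup_le h1) ((le_ciInf fun ν => hl ν s).trans
      (le_ciSup (f := fun μ => ⨅ ν, G.avgReward μ ν s) ⟨J, ?_⟩ μ'))
    rintro _ ⟨μ, rfl⟩
    exact h1 μ
  · refine le_antisymm ((ciInf_le (f := fun ν => ⨆ μ, G.avgReward μ ν s) ⟨J, ?_⟩ ν').trans
      (ciSup_le fun μ => hu μ s)) (le_ciInf h2)
    rintro _ ⟨ν, rfl⟩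
    exact h2 ν

end Average

end Game

/-! ### The diameter and the vanishing-discount limit. -/

namespace Game

open Filter Topology

variable {S A B : Type*} [Fintype S] [Fintype A] [Fintype B] (G : Game S A B)

section Hitting

variable [DecidableEq S]

theorem avoid_nonneg (μ : S → Dist A) (ν : S → Dist B) (g : S) (n : ℕ) (s : S) :
    0 ≤ G.avoid μ ν g n s := by
  induction n generalizing s with
  | zero => rw [avoid]; split_ifs <;> norm_num
  | succ n ih =>
    rw [avoid]
    split_ifs
    · exact le_rfl
    · exact Finset.sum_nonneg fun s' _ => mul_nonneg (G.trans_nonneg μ ν s s') (ih s')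

theorem sum_avoid_le {μ : S → Dist A} {ν : S → Dist B} {s g : S} {c : ℝ} (hc : 0 ≤ c)
    (h : G.hittingTime μ ν s g ≤ ENNReal.ofReal c) (n : ℕ) :
    ∑ k ∈ Finset.range n, G.avoid μ ν g k s ≤ c := by
  rw [← ENNReal.ofReal_le_ofReal_iff hc,
    ENNReal.ofReal_sum_of_nonneg fun k _ => G.avoid_nonneg μ ν g k s]
  exact (ENNReal.sum_le_tsum _).trans h

/-- A function that decreases by at most one per step, up to discounting, on the way to a
target is bounded by the expected travel time. -/
theorem le_of_hittingTime_le {μ : S → Dist A} {ν : S → Dist B} {s g : S} {c γ : ℝ} (hc : 0 ≤ c)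
    (h0 : 0 ≤ γ) (h1 : γ < 1) {u : S → ℝ} (hg : u g ≤ 0)
    (hu : ∀ s, u s ≤ 1 + γ * (G.trans μ ν).mulVec u s)
    (h : G.hittingTime μ ν s g ≤ ENNReal.ofReal c) : u s ≤ c := by
  obtain ⟨M, hM⟩ := exists_abs_le u
  have hM0 : 0 ≤ M := (abs_nonneg _).trans (hM s)
  -- Unrolling `n` steps charges one unit for each time at which the target has not been hit;
  -- discounting removes the remainder, of size `M * γ ^ n`.
  have key : ∀ n s, u s ≤ ∑ k ∈ Finset.range n, G.avoid μ ν g k s + M * γ ^ n := by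
    intro n
    induction n with
    | zero => intro s; simpa using (le_abs_self _).trans (hM s)
    | succ n ih =>
      intro s
      by_cases hs : s = g
      · rw [hs]
        exact hg.trans (add_nonneg (Finset.sum_nonneg fun k _ => G.avoid_nonneg μ ν g k g)
          (by positivity))
      · have hle := mulVec_le_mulVec (G.trans_nonneg μ ν) ih s
        have h0' : G.avoid μ ν g 0 s = 1 := by rw [avoid, if_neg hs]
        have hsum : (G.trans μ ν).mulVec
            (fun s' => ∑ k ∈ Finset.range n, G.avoid μ ν g k s' + M * γ ^ n) s =
            ∑ k ∈ Finset.range n, G.avoid μ ν g (k + 1) s + M * γ ^ n := by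
          simp only [Matrix.mulVec, dotProduct, mul_add, Finset.sum_add_distrib,
            ← Finset.sum_mul, G.sum_trans, one_mul, Finset.mul_sum]
          rw [Finset.sum_comm]
          simp only [avoid, if_neg hs]
        rw [hsum] at hle
        have hn : 0 ≤ ∑ k ∈ Finset.range n, G.avoid μ ν g (k + 1) s :=
          Finset.sum_nonneg fun k _ => G.avoid_nonneg μ ν g _ s
        rw [Finset.sum_range_succ', h0', pow_succ]
        have := hu s
        nlinarith [mul_le_mul_of_nonneg_left hle h0, mul_le_mul_of_nonneg_right h1.le hn]
  have hlim : Tendsto (fun n : ℕ => c + M * γ ^ n) atTop (𝓝 (c + M * 0)) :=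
    ((tendsto_pow_atTop_nhds_zero_of_lt_one h0 h1).const_mul M).const_add c
  rw [mul_zero, add_zero] at hlim
  exact ge_of_tendsto' hlim fun n => (key n s).trans
    (by gcongr; exact G.sum_avoid_le hc h n)

/-- The slack `ε` is there because the infimum over `μ` is not known to be attained. -/
theorem exists_hittingTime_le {D ε : ℝ} (hD : 0 ≤ D) (h : G.diameter ≤ ENNReal.ofReal D)
    (hε : 0 < ε) (ν : S → Dist B) (s g : S) :
    ∃ μ, G.hittingTime μ ν s g ≤ ENNReal.ofReal (D + ε) := by
  have h1 : ⨅ μ, G.hittingTime μ ν s g < ENNReal.ofReal (D + ε) :=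
    calc _ ≤ G.diameter := le_iSup_of_le s (le_iSup_of_le g (le_iSup_of_le ν le_rfl))
      _ ≤ ENNReal.ofReal D := h
      _ < _ := by rw [ENNReal.ofReal_lt_ofReal_iff (by linarith)]; linarith
  obtain ⟨μ, hμ⟩ := iInf_lt_iff.1 h1
  exact ⟨μ, hμ.le⟩

/-- The discounted value function varies by at most the diameter. -/
theorem shapley_fixedPoint_sub_le [Nonempty A] [Nonempty B] {D γ : ℝ} (hD : 0 ≤ D)
    (h : G.diameter ≤ ENNReal.ofReal D) (h0 : 0 ≤ γ) (h1 : γ < 1) {v : S → ℝ}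
    (hv : G.shapley γ v = v) {g : S} (hg : (1 - γ) * v g ≤ 1) (s : S) : v g - v s ≤ D := by
  refine le_of_forall_pos_le_add fun ε hε => ?_
  -- The minimizer plays optimally in the discounted game, so any response `μ` earns at most `v`;
  -- rewards being non-negative, `v ≥ γ P v` along `μ`.
  set ν : S → Dist B := fun s => (saddle fun a b => G.r s a b + γ * G.expect v s a b).2
  obtain ⟨μ, hμ⟩ := G.exists_hittingTime_le hD h hε ν s g
  refine G.le_of_hittingTime_le (u := fun s => v g - v s) (by linarith) h0 h1 (by simp)
    (fun s => ?_) hμ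
  have hvs : mix (μ s) (ν s) (fun a b => G.r s a b + γ * G.expect v s a b) ≤ v s :=
    ((isNashSolver_saddle _).1 (μ s)).trans_eq (congrFun hv s)
  rw [mix_add (μ s) (ν s) (G.r s), mix_mul_left] at hvs
  have hr : 0 ≤ mix (μ s) (ν s) (G.r s) := le_mix _ _ fun a b => (G.r_mem s a b).1
  rw [G.mulVec_trans, show G.expect (fun s => v g - v s) s = fun a b => v g - G.expect v s a b from
    funext₂ fun a b => by rw [expect_sub, expect_const], mix_sub, mix_const]
  linarith

end Hitting

theorem continuous_matrixValue [Nonempty A] [Nonempty B] :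
    Continuous (matrixValue : (A → B → ℝ) → ℝ) :=
  (LipschitzWith.of_dist_le_mul (K := 1) fun M M' => by
    rw [Real.dist_eq, NNReal.coe_one, one_mul]
    exact abs_matrixValue_sub_le fun a b => by
      rw [← Real.dist_eq]
      exact (dist_le_pi_dist (M a) (M' a) b).trans (dist_le_pi_dist M M' a)).continuous

/-- Under the diameter condition, the optimality equation of the average-reward game has a
solution whose bias is bounded by the diameter. -/
theorem exists_optimality [Nonempty S] [Nonempty A] [Nonempty B] [DecidableEq S] {D : ℝ}
    (hD : 0 ≤ D) (h : G.diameter ≤ ENNReal.ofReal D) :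
    ∃ (J : ℝ) (b : S → ℝ), J ∈ Set.Icc (0 : ℝ) 1 ∧ (∀ s, b s ∈ Set.Icc (-D) 0) ∧
      ∀ s, J + b s = matrixValue fun x y => G.r s x y + G.expect b s x y := by
  set γ : ℕ → ℝ := fun n => 1 - 1 / ((n : ℝ) + 1) with hγ
  have hγ0 : ∀ n, 0 ≤ γ n := fun n => by
    have : 1 / ((n : ℝ) + 1) ≤ 1 := by
      rw [div_le_one (by positivity)]; linarith [Nat.cast_nonneg (α := ℝ) n]
    simp only [hγ]; linarith
  have hγ1 : ∀ n, γ n < 1 := fun n => by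
    have : 0 < 1 / ((n : ℝ) + 1) := by positivity
    simp only [hγ]; linarith
  have hγl : Tendsto γ atTop (𝓝 1) := by
    simpa [hγ] using (tendsto_one_div_add_atTop_nhds_zero_nat (𝕜 := ℝ)).const_sub 1
  choose v hv using fun n => G.exists_shapley_fixedPoint (hγ0 n) (hγ1 n)
  choose g hg using fun n => Finite.exists_max (v n)
  choose l hl using fun n => Finite.exists_min (v n)
  have hv' : ∀ n s, v n s = matrixValue fun a b => G.r s a b + γ n * G.expect (v n) s a b :=
    fun n s => (congrFun (hv n) s).symm
  have hM : ∀ n, (1 - γ n) * v n (g n) ≤ 1 := fun n => by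
    have : v n (g n) ≤ 1 + γ n * v n (g n) := by
      conv_lhs => rw [hv']
      exact mix_le _ _ fun a b => add_le_add (G.r_mem _ a b).2
        (mul_le_mul_of_nonneg_left (G.expect_le (hg n) _ a b) (hγ0 n))
    linarith
  have hm : ∀ n, 0 ≤ v n (l n) := fun n => by
    have : γ n * v n (l n) ≤ v n (l n) := by
      conv_rhs => rw [hv']
      refine le_mix _ _ fun a b => ?_
      linarith [(G.r_mem (l n) a b).1,
        mul_le_mul_of_nonneg_left (G.le_expect (hl n) (l n) a b) (hγ0 n)]
    nlinarith [hγ1 n]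
  -- Rescaled maximal value and value relative to the maximum: these pairs lie in a compact box, and
  -- a limit point is the required `(J, b)`.
  set x : ℕ → ℝ × (S → ℝ) := fun n => ((1 - γ n) * v n (g n), fun s => v n s - v n (g n)) with hx
  have hxK : ∀ n, x n ∈ Set.Icc (0 : ℝ) 1 ×ˢ Set.pi Set.univ fun _ : S => Set.Icc (-D) 0 := by
    intro n
    refine ⟨⟨mul_nonneg (sub_nonneg.2 (hγ1 n).le) ((hm n).trans (hl n _)), hM n⟩, fun s _ => ?_⟩
    have := G.shapley_fixedPoint_sub_le hD h (hγ0 n) (hγ1 n) (hv n) (hM n) s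
    have := hg n s
    constructor <;> simp only [hx] <;> linarith
  obtain ⟨⟨J, b⟩, hJb, φ, hφ, hlim⟩ :=
    (isCompact_Icc.prod (isCompact_univ_pi fun _ => isCompact_Icc)).tendsto_subseq hxK
  refine ⟨J, b, hJb.1, fun s => hJb.2 s trivial, fun s => ?_⟩
  have hcont : Continuous fun z : ℝ × ℝ × (S → ℝ) =>
      z.2.1 + z.2.2 s - matrixValue fun a b => G.r s a b + z.1 * G.expect z.2.2 s a b := by
    refine Continuous.sub (by fun_prop) (continuous_matrixValue.comp ?_)
    refine continuous_pi fun a => continuous_pi fun b => ?_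
    simp only [expect]
    fun_prop
  -- The discounted equation after subtracting the constant `v n (g n)`; its residual is jointly
  -- continuous, so the equation survives in the limit.
  have hz : ∀ n, (x n).1 + (x n).2 s -
      matrixValue (fun a b => G.r s a b + γ n * G.expect (x n).2 s a b) = 0 := by
    intro n
    have h2 := hv' n s
    have h3 := matrixValue_add_const
      (fun a b => G.r s a b + γ n * G.expect (x n).2 s a b) (γ n * v n (g n))
    have h4 : (fun a b => G.r s a b + γ n * G.expect (x n).2 s a b + γ n * v n (g n)) =
        fun a b => G.r s a b + γ n * G.expect (v n) s a b := by
      funext a b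
      simp only [hx]
      rw [expect_sub, expect_const]
      ring
    rw [h4, ← h2] at h3
    simp only [hx] at h3 ⊢
    linarith
  have ht := (hcont.tendsto (1, J, b)).comp
    (((hγl.comp hφ.tendsto_atTop)).prodMk_nhds hlim)
  have h0 := tendsto_nhds_unique ht (tendsto_const_nhds.congr fun n => (hz (φ n)).symm)
  simp only [one_mul] at h0
  linarith

end Game

/-! ### From the law of the interaction to iterated one-step expectations. -/

section Expectation

/-- The expectation of a real function under a `PMF`, meant for finite supports. -/
def pmfExp {X : Type*} (p : PMF X) (F : X → ℝ) : ℝ := ∑' x, (p x).toReal * F x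

theorem pmfExp_pure {X : Type*} (x : X) (F : X → ℝ) : pmfExp (PMF.pure x) F = F x := by
  rw [pmfExp, tsum_eq_single x fun y hy => by simp [PMF.pure_apply, hy]]
  simp

theorem pmfExp_toPMF {X : Type*} [Fintype X] (p : Dist X) (F : X → ℝ) :
    pmfExp p.toPMF F = ∑ x, p.1 x * F x := by
  rw [pmfExp, tsum_fintype]
  refine Finset.sum_congr rfl fun x _ => ?_
  rw [Dist.toPMF, PMF.ofFintype_apply, ENNReal.toReal_ofReal (p.2.1 x)]

theorem pmfExp_bind {X Y : Type*} (p : PMF X) (f : X → PMF Y) (hp : p.support.Finite)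
    (hf : ∀ x, (f x).support.Finite) (F : Y → ℝ) :
    pmfExp (p.bind f) F = pmfExp p fun x => pmfExp (f x) F := by
  have hp0 : ∀ x ∉ hp.toFinset, p x = 0 := fun x hx => by
    simpa [PMF.mem_support_iff] using hx
  have h1 : ∀ y, ((p.bind f) y).toReal * F y =
      ∑ x ∈ hp.toFinset, (p x).toReal * ((f x y).toReal * F y) := fun y => by
    rw [PMF.bind_apply, tsum_eq_sum (s := hp.toFinset) fun x hx => by rw [hp0 x hx, zero_mul],
      ENNReal.toReal_sum fun x _ => ENNReal.mul_ne_top (p.apply_ne_top x) ((f x).apply_ne_top y),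
      Finset.sum_mul]
    exact Finset.sum_congr rfl fun x _ => by rw [ENNReal.toReal_mul, mul_assoc]
  have h2 : ∀ x, Summable fun y => (f x y).toReal * F y := fun x =>
    summable_of_ne_finset_zero (s := (hf x).toFinset) fun y hy => by
      have : f x y = 0 := by simpa [PMF.mem_support_iff] using hy
      simp [this]
  rw [pmfExp, tsum_congr h1, Summable.tsum_finsetSum fun x _ => (h2 x).mul_left _, pmfExp,
    tsum_eq_sum (s := hp.toFinset) fun x hx => by simp [hp0 x hx]]
  exact Finset.sum_congr rfl fun x _ => by rw [tsum_mul_left, pmfExp]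

theorem finite_support_bind {X Y : Type*} {p : PMF X} {f : X → PMF Y} (hp : p.support.Finite)
    (hf : ∀ x, (f x).support.Finite) : (p.bind f).support.Finite := by
  rw [PMF.support_bind]
  exact hp.biUnion fun x _ => hf x

end Expectation

section Law

variable {S A B : Type*} [Fintype S] [Fintype A] [Fintype B] [DecidableEq S] [DecidableEq A]
  [DecidableEq B] (G : Game S A B) (nash : (A → B → ℝ) → Dist A × Dist B) (D H δ : ℝ) (T : ℕ)

/-- The stage that follows the stage `g` when the actions `a`, `b` lead to the state `s'`. -/
def nextStage (g : Stage S A B) (a : A) (b : B) (s' : S) : Stage S A B :=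
  ⟨(g.state, a, b) :: g.rounds, s',
    g.memory.update nash D H δ T g.state a b (G.r g.state a b) s'⟩

variable (opp : Opponent S A B) (s₁ : S)

/-- The expectation of a function of the next stage, given the current stage. -/
def stepExp (F : Stage S A B → ℝ) (g : Stage S A B) : ℝ :=
  mix (g.memory.μ g.state) (opp g.rounds g.state) fun a b =>
    G.expect (fun s' => F (nextStage G nash D H δ T g a b s')) g.state a b

/-- The expectation of a function of the stage that is reached after `t` rounds. -/
def stageExp [Nonempty A] : ℕ → (Stage S A B → ℝ) → ℝ
  | 0, F => F ⟨[], s₁, Memory.init S A B H⟩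
  | t + 1, F => stageExp t (stepExp G nash D H δ T opp F)

theorem finite_support_toPMF {X : Type*} [Fintype X] (p : Dist X) : p.toPMF.support.Finite :=
  Set.toFinite _

theorem finite_support_pure {X : Type*} (x : X) : (PMF.pure x).support.Finite := by
  rw [PMF.support_pure]; exact Set.finite_singleton x

theorem finite_support_law [Nonempty A] (t : ℕ) :
    (law G nash D H δ T opp s₁ t).support.Finite := by
  induction t with
  | zero => exact finite_support_pure _
  | succ t ih =>
    exact finite_support_bind ih fun g => finite_support_bind (finite_support_toPMF _) fun a =>
      finite_support_bind (finite_support_toPMF _) fun b =>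
        finite_support_bind (finite_support_toPMF _) fun s' => finite_support_pure _

/-- Finite supports make all interchanges of sums legitimate. The analysis then needs only one-step
inequalities for functions of the stage, whatever the opponent does. -/
theorem pmfExp_law [Nonempty A] (t : ℕ) (F : Stage S A B → ℝ) :
    pmfExp (law G nash D H δ T opp s₁ t) F = stageExp G nash D H δ T opp s₁ t F := by
  induction t generalizing F with
  | zero => exact pmfExp_pure _ _
  | succ t ih =>
    have h3 : ∀ (g : Stage S A B) (a : A) (b : B), ((G.P g.state a b).toPMF.bind fun s' =>
        PMF.pure (nextStage G nash D H δ T g a b s')).support.Finite := fun g a b =>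
      finite_support_bind (finite_support_toPMF _) fun s' => finite_support_pure _
    have h2 : ∀ (g : Stage S A B) (a : A), ((opp g.rounds g.state).toPMF.bind fun b =>
        (G.P g.state a b).toPMF.bind fun s' =>
        PMF.pure (nextStage G nash D H δ T g a b s')).support.Finite := fun g a =>
      finite_support_bind (finite_support_toPMF _) (h3 g a)
    rw [stageExp, ← ih, law]
    refine (pmfExp_bind _ _ (finite_support_law ..)
      (fun g => finite_support_bind (finite_support_toPMF _) (h2 g)) F).trans ?_
    congr 1
    funext g
    rw [pmfExp_bind _ _ (finite_support_toPMF _) (h2 g), pmfExp_toPMF, stepExp, mix]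
    refine Finset.sum_congr rfl fun a _ => ?_
    rw [pmfExp_bind _ _ (finite_support_toPMF _) (h3 g a), pmfExp_toPMF, Finset.mul_sum]
    refine Finset.sum_congr rfl fun b _ => ?_
    rw [pmfExp_bind _ _ (finite_support_toPMF _) fun s' => finite_support_pure _, pmfExp_toPMF,
      mul_assoc]
    simp only [pmfExp_pure, Game.expect]

theorem expectedRegret_eq [Nonempty A] (J : ℝ) :
    expectedRegret G J nash D H δ T opp s₁ =
      stageExp G nash D H δ T opp s₁ T fun g => regret G J g.rounds :=
  pmfExp_law ..

theorem stepExp_mono {F F' : Stage S A B → ℝ} {g : Stage S A B}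
    (h : ∀ a b s', F (nextStage G nash D H δ T g a b s') ≤ F' (nextStage G nash D H δ T g a b s')) :
    stepExp G nash D H δ T opp F g ≤ stepExp G nash D H δ T opp F' g :=
  mix_mono _ _ fun a b => G.expect_mono (h a b) _ a b

theorem stepExp_add (F F' : Stage S A B → ℝ) (g : Stage S A B) :
    stepExp G nash D H δ T opp (fun g => F g + F' g) g =
      stepExp G nash D H δ T opp F g + stepExp G nash D H δ T opp F' g := by
  simp only [stepExp, Game.expect_add, mix_add]

theorem stepExp_mul_left (c : ℝ) (F : Stage S A B → ℝ) (g : Stage S A B) :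
    stepExp G nash D H δ T opp (fun g => c * F g) g = c * stepExp G nash D H δ T opp F g := by
  simp only [stepExp, Game.expect_mul_left, mix_mul_left]

theorem stepExp_const (c : ℝ) (g : Stage S A B) :
    stepExp G nash D H δ T opp (fun _ => c) g = c := by
  simp only [stepExp, Game.expect_const, mix_const]

variable [Nonempty A]

theorem stageExp_add (t : ℕ) (F F' : Stage S A B → ℝ) :
    stageExp G nash D H δ T opp s₁ t (fun g => F g + F' g) =
      stageExp G nash D H δ T opp s₁ t F + stageExp G nash D H δ T opp s₁ t F' := by
  induction t generalizing F F' with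
  | zero => rfl
  | succ t ih => simp only [stageExp, ← ih, ← stepExp_add]

theorem stageExp_mul_left (t : ℕ) (c : ℝ) (F : Stage S A B → ℝ) :
    stageExp G nash D H δ T opp s₁ t (fun g => c * F g) =
      c * stageExp G nash D H δ T opp s₁ t F := by
  induction t generalizing F with
  | zero => rfl
  | succ t ih => simp only [stageExp, ← ih, ← stepExp_mul_left]

theorem stageExp_const (t : ℕ) (c : ℝ) :
    stageExp G nash D H δ T opp s₁ t (fun _ => c) = c := by
  induction t with
  | zero => rfl
  | succ t ih =>
    rw [stageExp, show stepExp G nash D H δ T opp (fun _ => c) = fun _ => c from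
      funext fun g => stepExp_const .., ih]

end Law

/-! ### Concentration for one estimator through an exponential potential. -/

/-- If `x` is centred and bounded by `D`, then `exp (θ x)` has mean at most `exp ((θ D)² / 2)`. -/
theorem sum_mul_exp_le {S : Type*} [Fintype S] (p : Dist S) {x : S → ℝ} {D : ℝ} (hD : 0 < D)
    (hx : ∀ s, |x s| ≤ D) (h0 : ∑ s, p.1 s * x s = 0) (θ : ℝ) :
    ∑ s, p.1 s * Real.exp (θ * x s) ≤ Real.exp ((θ * D) ^ 2 / 2) := by
  -- On `[-D, D]` the exponential lies below its chord, whose linear part has mean zero.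
  have hconv : ∀ s, Real.exp (θ * x s) ≤
      Real.cosh (θ * D) + x s * (Real.sinh (θ * D) / D) := fun s => by
    have h := abs_le.1 (hx s)
    have ha : 0 ≤ (D + x s) / (2 * D) := div_nonneg (by linarith) (by linarith)
    have hb : 0 ≤ (D - x s) / (2 * D) := div_nonneg (by linarith) (by linarith)
    have := convexOn_exp.2 (Set.mem_univ (θ * D)) (Set.mem_univ (-(θ * D))) ha hb
      (by field_simp; ring)
    simp only [smul_eq_mul] at this
    have e1 : (D + x s) / (2 * D) * (θ * D) + (D - x s) / (2 * D) * -(θ * D) = θ * x s := by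
      field_simp; ring
    rw [e1] at this
    refine this.trans_eq ?_
    rw [Real.cosh_eq, Real.sinh_eq]
    field_simp
    ring
  calc ∑ s, p.1 s * Real.exp (θ * x s)
      ≤ ∑ s, p.1 s * (Real.cosh (θ * D) + x s * (Real.sinh (θ * D) / D)) :=
        Finset.sum_le_sum fun s _ => mul_le_mul_of_nonneg_left (hconv s) (p.2.1 s)
    _ = Real.cosh (θ * D) := by
        simp only [mul_add, Finset.sum_add_distrib, ← mul_assoc, ← Finset.sum_mul, h0, p.2.2]
        ring
    _ ≤ _ := Real.cosh_le_exp_half_sq _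

theorem exp_mul_le {ρ x : ℝ} (h0 : 0 ≤ ρ) (h1 : ρ ≤ 1) : Real.exp (ρ * x) ≤ Real.exp x + 1 := by
  rcases le_total x 0 with hx | hx
  · have : Real.exp (ρ * x) ≤ 1 := Real.exp_le_one_iff.2 (mul_nonpos_of_nonneg_of_nonpos h0 hx)
    linarith [Real.exp_pos x]
  · have : Real.exp (ρ * x) ≤ Real.exp x := Real.exp_le_exp.2 (by nlinarith)
    linarith

theorem learningRate_succ_nonneg {H : ℝ} (hH : 1 ≤ H) (k : ℕ) : 0 ≤ learningRate H (k + 1) := by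
  rw [learningRate]; positivity

theorem learningRate_succ_le_one {H : ℝ} (hH : 1 ≤ H) (k : ℕ) : learningRate H (k + 1) ≤ 1 := by
  have : (0 : ℝ) ≤ k := k.cast_nonneg
  rw [learningRate, div_le_one (by positivity)]
  push_cast
  linarith

/-- The exponential potential of the deviations of the estimator of one entry. -/
theorem exp_potential_step {S : Type*} [Fintype S] (p : Dist S) {x : S → ℝ} {D H l : ℝ}
    (hD : 0 < D) (hH : 1 ≤ H) (hl : 0 ≤ l) (hx : ∀ s, |x s| ≤ D) (h0 : ∑ s, p.1 s * x s = 0)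
    (k : ℕ) (y : ℝ) :
    ∑ s, p.1 s * Real.exp (l - Real.sqrt ((k + 1 : ℕ) * l / H) / D *
      ((1 - learningRate H (k + 1)) * y +
        learningRate H (k + 1) * (x s + 2 * D * Real.sqrt (H * l / (k + 1 : ℕ))))) ≤
      Real.exp (Real.sqrt (k * (k + 1 : ℕ)) / (H + (k + 1 : ℕ)) *
        (l - Real.sqrt (k * l / H) / D * y)) := by
  have hk : (0 : ℝ) ≤ k := k.cast_nonneg
  have hK : ((k + 1 : ℕ) : ℝ) = k + 1 := by push_cast; ring
  set K : ℝ := ((k + 1 : ℕ) : ℝ) with hKdef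
  have hK1 : 1 ≤ K := by linarith
  have hH0 : 0 < H := by linarith
  set α := learningRate H (k + 1) with hα
  have hα' : α = (H + 1) / (H + K) := by rw [hα, learningRate, ← hKdef]
  set lam := Real.sqrt (K * l / H) / D with hlam
  set ρ := Real.sqrt (k * K) / (H + K) with hρ
  -- Budget of the exponent: the bonus contributes `-2 l α`. Of this, `h4` spends `l α` on the
  -- variance term; what is left of `l` is `l (1 - α) ≤ ρ l` by `h3`. By `h2` the coefficient of `y`
  -- is exactly `ρ` times the old one.
  have h1 : lam * (2 * D * Real.sqrt (H * l / K)) = 2 * l := by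
    have : Real.sqrt (K * l / H) * Real.sqrt (H * l / K) = l := by
      rw [← Real.sqrt_mul (by positivity), show K * l / H * (H * l / K) = l * l by field_simp,
        Real.sqrt_mul_self hl]
    calc _ = 2 * (Real.sqrt (K * l / H) * Real.sqrt (H * l / K)) := by
          rw [hlam]; field_simp
      _ = _ := by rw [this]
  have h2 : lam * (1 - α) = ρ * (Real.sqrt (k * l / H) / D) := by
    have e1 : Real.sqrt (k * K) * Real.sqrt (k * l / H) = k * Real.sqrt (K * l / H) := by
      rw [← Real.sqrt_mul (by positivity), show k * K * (k * l / H) = k ^ 2 * (K * l / H) by ring,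
        Real.sqrt_mul (by positivity), Real.sqrt_sq hk]
    have e2 : 1 - α = k / (H + K) := by
      rw [hα']; field_simp; rw [hK]; ring
    calc lam * (1 - α) = (k * Real.sqrt (K * l / H)) / (H + K) / D := by
          rw [e2, hlam]; ring
      _ = _ := by rw [← e1, hρ]; ring
  have h3 : 1 - ρ ≤ α := by
    have : k ≤ Real.sqrt (k * K) := Real.le_sqrt_of_sq_le (by nlinarith)
    rw [hα', hρ, sub_le_iff_le_add, ← add_div, one_le_div (by positivity)]
    linarith
  have hα0 : 0 ≤ α := learningRate_succ_nonneg hH k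
  have h4 : (lam * α * D) ^ 2 / 2 ≤ l * α := by
    have e1 : (lam * α * D) ^ 2 = K * l / H * α ^ 2 := by
      have : lam * α * D = Real.sqrt (K * l / H) * α := by rw [hlam]; field_simp
      rw [this, mul_pow, Real.sq_sqrt (by positivity)]
    have e2 : K / (2 * H) * α ≤ 1 := by
      rw [hα', div_mul_div_comm, div_le_one (by positivity)]
      nlinarith
    rw [e1, show K * l / H * α ^ 2 / 2 = l * α * (K / (2 * H) * α) by ring]
    exact mul_le_of_le_one_right (by positivity) e2
  have hsum := sum_mul_exp_le p hD hx h0 (-(lam * α))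
  set Z := l - ρ * (Real.sqrt (k * l / H) / D) * y - 2 * l * α with hZ
  calc _ = Real.exp Z * ∑ s, p.1 s * Real.exp (-(lam * α) * x s) := by
        rw [Finset.mul_sum]
        refine Finset.sum_congr rfl fun s _ => ?_
        rw [mul_left_comm, ← Real.exp_add]
        congr 2
        rw [hZ, ← h2, ← h1]
        ring
    _ ≤ Real.exp Z * Real.exp ((-(lam * α) * D) ^ 2 / 2) :=
        mul_le_mul_of_nonneg_left hsum (Real.exp_pos _).le
    _ ≤ _ := by
        rw [← Real.exp_add, Real.exp_le_exp, show (-(lam * α) * D) ^ 2 = (lam * α * D) ^ 2 by ring,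
          hZ]
        nlinarith [mul_le_mul_of_nonneg_left h3 hl]

/-- A potential that controls the deviations of the estimator of one entry: it grows by at most
one per visit in expectation, and it is at least `exp l` when the estimator is negative. -/
theorem exists_potential (S : Type*) [Fintype S] {D H l : ℝ} (hD : 0 ≤ D) (hH : 1 ≤ H)
    (hl : 0 ≤ l) :
    ∃ φ : ℕ → ℝ → ℝ, (∀ k y, 0 ≤ φ k y) ∧ (∀ k, Antitone (φ k)) ∧ (∀ y, 0 ≤ y → φ 0 y = 0) ∧
      (∀ k y, y < 0 → Real.exp l ≤ φ (k + 1) y) ∧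
      ∀ (p : Dist S) (x : S → ℝ), (∀ s, |x s| ≤ D) → ∑ s, p.1 s * x s = 0 → ∀ (k : ℕ) (y : ℝ),
        ∑ s, p.1 s * φ (k + 1) ((1 - learningRate H (k + 1)) * y +
          learningRate H (k + 1) * (x s + 2 * D * Real.sqrt (H * l / (k + 1 : ℕ)))) ≤
          φ k y + 1 := by
  -- For `D = 0` noise and bonus both vanish and a non-negative deviation stays so; an indicator
  -- suffices, whereas the general potential divides by `D`.
  rcases hD.eq_or_lt with rfl | hD
  · refine ⟨fun k y => if y < 0 then Real.exp l else 0, fun k y => ?_, fun k y z hyz => ?_,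
      fun y hy => if_neg hy.not_gt, fun k y hy => by simp [hy], fun p x hx h0 k y => ?_⟩
    · positivity
    · by_cases hz : z < 0
      · simp [hz, hyz.trans_lt hz]
      · simp only [hz, if_false]; positivity
    · have hx0 : ∀ s, x s = 0 := fun s => abs_nonpos_iff.1 (hx s)
      simp only [hx0, mul_zero, zero_mul, add_zero, ← Finset.sum_mul, p.2.2, one_mul]
      by_cases hy : y < 0
      · simp only [hy, if_true]
        split_ifs
        · linarith
        · positivity
      · rw [if_neg (not_lt.2 (mul_nonneg (sub_nonneg.2 (learningRate_succ_le_one hH k))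
          (not_lt.1 hy))), if_neg hy]
        norm_num
  · have hH0 : 0 < H := by linarith
    -- The weight `√(k l / H) / D` makes weight times bonus equal to `2 l` at every count. Without
    -- the exception at `k = 0`, each unvisited entry would already contribute `exp l`.
    refine ⟨fun k y => if k = 0 then 0 else
      Real.exp (l - Real.sqrt (k * l / H) / D * y), fun k y => ?_, fun k y z hyz => ?_,
      fun y hy => if_pos rfl, fun k y hy => ?_, fun p x hx h0 k y => ?_⟩
    · positivity
    · dsimp only
      split_ifs
      · exact le_rfl
      · gcongr
    · simp only [Nat.succ_ne_zero, if_false, Real.exp_le_exp, le_sub_self_iff]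
      exact mul_nonpos_of_nonneg_of_nonpos (by positivity) hy.le
    · simp only [Nat.succ_ne_zero, if_false]
      refine (exp_potential_step p hD hH hl hx h0 k y).trans ?_
      -- At the first visit the contraction factor is zero and the bound is `exp 0 = 1`; later the
      -- factor is at most one, which costs at most the additive one of `exp_mul_le`.
      rcases Nat.eq_zero_or_pos k with rfl | hk
      · simp
      · rw [if_neg hk.ne']
        refine exp_mul_le (by positivity) ?_
        have hK : (k : ℝ) ≤ (k + 1 : ℕ) := by push_cast; linarith
        rw [div_le_one (by positivity), Real.sqrt_le_left (by positivity)]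
        nlinarith [(Nat.cast_nonneg k : (0 : ℝ) ≤ k)]

/-! ### Updates of the memory and invariants that hold surely. -/

section Memory

variable {S A B : Type*} [Fintype A]

/-- The updated estimator of the visited entry. -/
def Memory.newQ (D H δ : ℝ) (T : ℕ) (m : Memory S A B)
    (s : S) (a : A) (b : B) (x : ℝ) (s' : S) : ℝ :=
  (1 - learningRate H (m.N s a b + 1)) * m.Q s a b + learningRate H (m.N s a b + 1) *
    (x + (1 - 1 / H) * m.Vdown s' + bonus D H δ T (m.N s a b + 1))

variable {D H δ : ℝ} {T : ℕ} {m : Memory S A B} {s : S} {a : A} {b : B} {x : ℝ} {s' : S}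

theorem bonus_nonneg {τ : ℕ} (hD : 0 ≤ D) : 0 ≤ bonus D H δ T τ := by
  rw [bonus]; positivity

theorem Memory.newQ_nonneg (hD : 0 ≤ D) (hH : 1 ≤ H) (hQ : 0 ≤ m.Q s a b)
    (hV : 0 ≤ m.Vdown s') (hx : 0 ≤ x) : 0 ≤ m.newQ D H δ T s a b x s' := by
  have h1 := learningRate_succ_nonneg hH (m.N s a b)
  have h2 := sub_nonneg.2 (learningRate_succ_le_one hH (m.N s a b))
  have h3 : 0 ≤ 1 - 1 / H := sub_nonneg.2 ((div_le_one (by linarith)).2 hH)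
  have h4 := bonus_nonneg (H := H) (δ := δ) (T := T) (τ := m.N s a b + 1) hD
  rw [newQ]
  positivity

/-- The recursion of the estimator, cleared of denominators. -/
theorem Memory.newQ_eq (hH : 0 < H) :
    (H + (m.N s a b + 1)) * m.newQ D H δ T s a b x s' = m.N s a b * m.Q s a b +
      (H + 1) * (x + (1 - 1 / H) * m.Vdown s' + bonus D H δ T (m.N s a b + 1)) := by
  have : H + ((m.N s a b : ℝ) + 1) ≠ 0 := by positivity
  rw [newQ, learningRate]
  push_cast
  generalize x + (1 - 1 / H) * m.Vdown s' + bonus D H δ T (m.N s a b + 1) = X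
  field_simp
  ring

variable [Fintype B]

/-- The value estimates are the values of the matrix games of the estimators, and the current
policies are optimal in them. -/
def Memory.Consistent (m : Memory S A B) : Prop :=
  ∀ s, ∃ q, IsNash (m.Qdown s) (m.μ s) q ∧ m.Vdown s = mix (m.μ s) q (m.Qdown s)

/-- Since `Qdown` never increases, this makes the value estimates non-increasing in time, as the
regret potential requires. -/
theorem Memory.Consistent.Vdown_le {m' : Memory S A B} (h : m.Consistent) (h' : m'.Consistent)
    {s : S} (hQ : ∀ a b, m.Qdown s a b ≤ m'.Qdown s a b) : m.Vdown s ≤ m'.Vdown s := by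
  obtain ⟨q, hq, hv⟩ := h s
  obtain ⟨q', hq', hv'⟩ := h' s
  rw [hv, hv']
  exact hq.mix_le_mix hq' hQ

end Memory

section Update

variable {S A B : Type*} [Fintype A] [Fintype B] [DecidableEq S] [DecidableEq A] [DecidableEq B]
  (nash : (A → B → ℝ) → Dist A × Dist B) (D H δ : ℝ) (T : ℕ) (m : Memory S A B)
  (s : S) (a : A) (b : B) (x : ℝ) (s' : S)

theorem Memory.update_N (i : S) (j : A) (k : B) :
    (m.update nash D H δ T s a b x s').N i j k =
      if i = s ∧ j = a ∧ k = b then m.N s a b + 1 else m.N i j k := rfl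

theorem Memory.update_Q (i : S) (j : A) (k : B) :
    (m.update nash D H δ T s a b x s').Q i j k =
      if i = s ∧ j = a ∧ k = b then m.newQ D H δ T s a b x s' else m.Q i j k := rfl

theorem Memory.update_Qdown (i : S) (j : A) (k : B) :
    (m.update nash D H δ T s a b x s').Qdown i j k =
      if i = s ∧ j = a ∧ k = b then min (m.Qdown s a b) (m.newQ D H δ T s a b x s')
      else m.Qdown i j k := rfl

theorem Memory.update_Qdown_of_ne {i : S} (hi : i ≠ s) :
    (m.update nash D H δ T s a b x s').Qdown i = m.Qdown i := by
  funext j k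
  simp [update_Qdown, hi]

theorem Memory.update_Qdown_le (i : S) (j : A) (k : B) :
    (m.update nash D H δ T s a b x s').Qdown i j k ≤ m.Qdown i j k := by
  rw [update_Qdown]
  split_ifs with h
  · obtain ⟨rfl, rfl, rfl⟩ := h; exact min_le_left _ _
  · exact le_rfl

theorem Memory.update_μ (i : S) :
    (m.update nash D H δ T s a b x s').μ i =
      if i = s then (nash ((m.update nash D H δ T s a b x s').Qdown s)).1 else m.μ i := rfl

theorem Memory.update_Vdown (i : S) :
    (m.update nash D H δ T s a b x s').Vdown i =
      if i = s then mix (nash ((m.update nash D H δ T s a b x s').Qdown s)).1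
        (nash ((m.update nash D H δ T s a b x s').Qdown s)).2
        ((m.update nash D H δ T s a b x s').Qdown s)
      else m.Vdown i := rfl

variable {nash D H δ T m s a b x s'}

theorem Memory.Consistent.update (hn : IsNashSolver nash) (h : m.Consistent) :
    (m.update nash D H δ T s a b x s').Consistent := by
  intro i
  by_cases hi : i = s
  · subst hi
    refine ⟨(nash ((m.update nash D H δ T i a b x s').Qdown i)).2, ?_, ?_⟩
    · rw [update_μ, if_pos rfl]; exact hn _
    · rw [update_Vdown, if_pos rfl, update_μ, if_pos rfl]
  · obtain ⟨q, hq, hv⟩ := h i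
    refine ⟨q, ?_, ?_⟩
    · rwa [update_μ, if_neg hi, update_Qdown_of_ne _ _ _ _ _ _ _ _ _ _ _ hi]
    · rwa [update_Vdown, if_neg hi, update_μ, if_neg hi,
        update_Qdown_of_ne _ _ _ _ _ _ _ _ _ _ _ hi]

end Update

variable {S A B : Type*} [Fintype S] [Fintype A] [Fintype B]

/-- The sum over all entries of a function of the visit count and the estimator. -/
def Memory.total (m : Memory S A B) (F : ℕ → ℝ → S × A × B → ℝ) : ℝ :=
  ∑ z : S × A × B, F (m.N z.1 z.2.1 z.2.2) (m.Q z.1 z.2.1 z.2.2) z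

section Update

variable [DecidableEq S] [DecidableEq A] [DecidableEq B]
  (nash : (A → B → ℝ) → Dist A × Dist B) (D H δ : ℝ) (T : ℕ) (m : Memory S A B)
  (s : S) (a : A) (b : B) (x : ℝ) (s' : S)

theorem Memory.total_update (F : ℕ → ℝ → S × A × B → ℝ) :
    (m.update nash D H δ T s a b x s').total F = m.total F +
      (F (m.N s a b + 1) (m.newQ D H δ T s a b x s') (s, a, b) -
        F (m.N s a b) (m.Q s a b) (s, a, b)) := by
  rw [← sub_eq_iff_eq_add', total, total, ← Finset.sum_sub_distrib,
    Finset.sum_eq_single (s, a, b)]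
  · simp [update_N, update_Q]
  · rintro ⟨i, j, k⟩ - hz
    have : ¬(i = s ∧ j = a ∧ k = b) := by simpa using hz
    simp [update_N, update_Q, this]
  · simp

end Update

/-- What is known about the stage after `t` rounds, whatever the actions and transitions were. -/
structure Reachable (H : ℝ) (t : ℕ) (g : Stage S A B) : Prop where
  length_eq : g.rounds.length = t
  total_visits : g.memory.total (fun n _ _ => n) = t
  consistent : g.memory.Consistent
  Qdown_nonneg : ∀ s a b, 0 ≤ g.memory.Qdown s a b
  Qdown_le : ∀ s a b, g.memory.Qdown s a b ≤ H
  Qdown_le_Q : ∀ s a b, g.memory.Qdown s a b ≤ g.memory.Q s a b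

namespace Reachable

variable {H : ℝ} {t : ℕ} {g : Stage S A B}

theorem Vdown_nonneg (h : Reachable H t g) (s : S) : 0 ≤ g.memory.Vdown s := by
  obtain ⟨q, -, hv⟩ := h.consistent s
  exact hv ▸ le_mix _ _ (h.Qdown_nonneg s)

theorem Vdown_le (h : Reachable H t g) (s : S) : g.memory.Vdown s ≤ H := by
  obtain ⟨q, -, hv⟩ := h.consistent s
  exact hv ▸ mix_le _ _ (h.Qdown_le s)

theorem init [Nonempty A] [Nonempty B] (hH : 0 ≤ H) (s : S) :
    Reachable H 0 (⟨[], s, Memory.init S A B H⟩ : Stage S A B) where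
  length_eq := rfl
  total_visits := by simp [Memory.total, Memory.init]
  consistent s := by
    refine ⟨Dist.uniform B, ⟨fun p' => ?_, fun q' => ?_⟩, ?_⟩ <;> simp [Memory.init, mix_const]
  Qdown_nonneg _ _ _ := hH
  Qdown_le _ _ _ := le_rfl
  Qdown_le_Q _ _ _ := le_rfl

variable [DecidableEq S] [DecidableEq A] [DecidableEq B]

theorem next {G : Game S A B} {nash : (A → B → ℝ) → Dist A × Dist B} {D δ : ℝ} {T : ℕ}
    (hn : IsNashSolver nash) (hD : 0 ≤ D) (hH : 1 ≤ H) (h : Reachable H t g)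
    (a : A) (b : B) (s' : S) : Reachable H (t + 1) (nextStage G nash D H δ T g a b s') where
  length_eq := by simp [nextStage, h.length_eq]
  total_visits := by
    rw [nextStage, Memory.total_update, h.total_visits]; push_cast; ring
  consistent := h.consistent.update hn
  Qdown_nonneg i j k := by
    rw [nextStage, Memory.update_Qdown]
    split_ifs
    · exact le_min (h.Qdown_nonneg _ _ _) (Memory.newQ_nonneg hD hH
        ((h.Qdown_nonneg _ _ _).trans (h.Qdown_le_Q _ _ _)) (h.Vdown_nonneg _) (G.r_mem _ _ _).1)
    · exact h.Qdown_nonneg i j k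
  Qdown_le i j k := (Memory.update_Qdown_le ..).trans (h.Qdown_le i j k)
  Qdown_le_Q i j k := by
    rw [nextStage, Memory.update_Qdown, Memory.update_Q]
    split_ifs
    · exact min_le_right _ _
    · exact h.Qdown_le_Q i j k

/-- The invariants pass to every possible next stage, so an inequality need only be checked on
reachable stages. -/
theorem stageExp_mono [Nonempty A] [Nonempty B] {G : Game S A B}
    {nash : (A → B → ℝ) → Dist A × Dist B}
    {D δ : ℝ} {T : ℕ} (hn : IsNashSolver nash) (hD : 0 ≤ D) (hH : 1 ≤ H) (opp : Opponent S A B)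
    (s₁ : S) (t : ℕ) {F F' : Stage S A B → ℝ} (hF : ∀ g, Reachable H t g → F g ≤ F' g) :
    stageExp G nash D H δ T opp s₁ t F ≤ stageExp G nash D H δ T opp s₁ t F' := by
  induction t generalizing F F' with
  | zero => exact hF _ (init (by linarith) s₁)
  | succ t ih =>
    exact ih fun g hg => stepExp_mono _ _ _ _ _ _ _ fun a b s' => hF _ (hg.next hn hD hH a b s')

end Reachable

/-! ### Optimism of the estimators and its failure probability. -/

/-- A run of DONQ-learning: the game with a solution of its average-reward optimality equation,
the parameters of the learner, and the opponent. -/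
structure Run (S A B : Type*) [Fintype S] [Fintype A] [Fintype B] [Nonempty A] [Nonempty B] where
  G : Game S A B
  nash : (A → B → ℝ) → Dist A × Dist B
  D : ℝ
  H : ℝ
  δ : ℝ
  T : ℕ
  opp : Opponent S A B
  J : ℝ
  h : S → ℝ
  isNashSolver : IsNashSolver nash
  D_nonneg : 0 ≤ D
  one_le_H : 1 ≤ H
  log_nonneg : 0 ≤ Real.log (2 * T / δ)
  J_mem : J ∈ Set.Icc (0 : ℝ) 1
  h_mem : ∀ s, h s ∈ Set.Icc (-D) 0
  optimality : ∀ s, J + h s = matrixValue fun a b => G.r s a b + G.expect h s a b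

namespace Run

variable {S A B : Type*} [Fintype S] [Fintype A] [Fintype B] [Nonempty A] [Nonempty B]
  (R : Run S A B)

/-- The optimistic comparison function for the value estimates. -/
def w (s : S) : ℝ := R.H * R.J + R.h s

/-- The comparison function for the estimators. -/
def c (s : S) (a : A) (b : B) : ℝ := R.G.r s a b + (1 - 1 / R.H) * R.G.expect R.w s a b

/-- The estimators of the memory are optimistic. -/
def Good (m : Memory S A B) : Prop := ∀ s a b, R.c s a b ≤ m.Qdown s a b

theorem H_pos : 0 < R.H := zero_lt_one.trans_le R.one_le_H

theorem discount_nonneg : 0 ≤ 1 - 1 / R.H :=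
  sub_nonneg.2 ((div_le_one R.H_pos).2 R.one_le_H)

theorem discount_le_one : 1 - 1 / R.H ≤ 1 :=
  sub_le_self _ (div_nonneg zero_le_one R.H_pos.le)

theorem expect_w (s : S) (a : A) (b : B) :
    R.G.expect R.w s a b = R.H * R.J + R.G.expect R.h s a b := by
  rw [show R.w = fun s => R.H * R.J + R.h s from rfl, Game.expect_add, Game.expect_const]

theorem expect_h_mem (s : S) (a : A) (b : B) : R.G.expect R.h s a b ∈ Set.Icc (-R.D) 0 :=
  ⟨R.G.le_expect (fun s => (R.h_mem s).1) s a b, R.G.expect_le (fun s => (R.h_mem s).2) s a b⟩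

theorem c_eq (s : S) (a : A) (b : B) :
    R.c s a b = R.G.r s a b + (R.H - 1) * R.J + (1 - 1 / R.H) * R.G.expect R.h s a b := by
  have := R.H_pos
  rw [c, expect_w]
  field_simp
  ring

/-- Makes the initial estimators, all equal to `H`, optimistic; uses `J ≤ 1` and `h ≤ 0`. -/
theorem c_le (s : S) (a : A) (b : B) : R.c s a b ≤ R.H := by
  rw [c_eq]
  nlinarith [(R.G.r_mem s a b).2, R.J_mem.2, R.one_le_H,
    mul_nonneg R.discount_nonneg (neg_nonneg.2 (R.expect_h_mem s a b).2)]

theorem neg_D_le_c (s : S) (a : A) (b : B) : -R.D ≤ R.c s a b := by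
  rw [c_eq]
  nlinarith [(R.G.r_mem s a b).1, mul_nonneg (sub_nonneg.2 R.one_le_H) R.J_mem.1,
    mul_le_mul_of_nonneg_left (R.expect_h_mem s a b).1 R.discount_nonneg,
    mul_le_mul_of_nonneg_right R.discount_le_one R.D_nonneg]

theorem bonus_eq (k : ℕ) : bonus R.D R.H R.δ R.T k =
    2 * R.D * Real.sqrt (R.H * Real.log (2 * R.T / R.δ) / k) := rfl

variable {R}

/-- Because `h ≤ 0`, discounting it only helps: `c ≥ r + P h + (H - 1) J`. The value of the right
side is `J + h + (H - 1) J = w` by the optimality equation. -/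
theorem Good.w_le_Vdown {m : Memory S A B} (hm : R.Good m) (hc : m.Consistent) (s : S) :
    R.w s ≤ m.Vdown s := by
  obtain ⟨q, hq, hv⟩ := hc s
  have := (isNashSolver_saddle fun a b => R.G.r s a b + R.G.expect R.h s a b).mix_le_mix_add hq
    (c := -((R.H - 1) * R.J)) fun a b => by
      have h1 := hm s a b
      rw [c_eq] at h1
      nlinarith [(R.expect_h_mem s a b).2, R.discount_le_one]
  have h2 := R.optimality s
  rw [matrixValue] at h2
  rw [w, hv]
  linarith

variable (R) in
/-- The updated estimator of the visited entry. -/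
def newQ (g : Stage S A B) (a : A) (b : B) (s' : S) : ℝ :=
  g.memory.newQ R.D R.H R.δ R.T g.state a b (R.G.r g.state a b) s'

/-- Replacing the value at the next state by its lower bound `w` cancels the constant `H J`, so the
noise is that of `h`, of size `D` and not `H`. -/
theorem newQ_sub_c_ge {g : Stage S A B} {t : ℕ} (hr : Reachable R.H t g) (hg : R.Good g.memory)
    (a : A) (b : B) (s' : S) :
    (1 - learningRate R.H (g.memory.N g.state a b + 1)) *
        (g.memory.Q g.state a b - R.c g.state a b) +
      learningRate R.H (g.memory.N g.state a b + 1) *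
        ((1 - 1 / R.H) * (R.h s' - R.G.expect R.h g.state a b) +
          2 * R.D * Real.sqrt (R.H * Real.log (2 * R.T / R.δ) /
            (g.memory.N g.state a b + 1 : ℕ))) ≤
      R.newQ g a b s' - R.c g.state a b := by
  have h1 := mul_le_mul_of_nonneg_left (mul_le_mul_of_nonneg_left
    (hg.w_le_Vdown hr.consistent s') R.discount_nonneg)
    (learningRate_succ_nonneg R.one_le_H (g.memory.N g.state a b))
  rw [newQ, Memory.newQ, bonus_eq]
  have h2 : R.c g.state a b = R.G.r g.state a b +
      (1 - 1 / R.H) * (R.H * R.J + R.G.expect R.h g.state a b) := by rw [c, expect_w]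
  rw [w] at h1
  linear_combination h1 + (learningRate R.H (g.memory.N g.state a b + 1)) * h2

theorem newQ_eq (g : Stage S A B) (a : A) (b : B) (s' : S) :
    (R.H + (g.memory.N g.state a b + 1)) * R.newQ g a b s' =
      g.memory.N g.state a b * g.memory.Q g.state a b +
      (R.H + 1) * (R.G.r g.state a b + (1 - 1 / R.H) * g.memory.Vdown s' +
        bonus R.D R.H R.δ R.T (g.memory.N g.state a b + 1)) :=
  Memory.newQ_eq R.H_pos

variable [DecidableEq S] [DecidableEq A] [DecidableEq B]

variable (R) in
/-- The next stage of the run. -/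
def next (g : Stage S A B) (a : A) (b : B) (s' : S) : Stage S A B :=
  nextStage R.G R.nash R.D R.H R.δ R.T g a b s'

variable (R) in
/-- The expectation of a function of the next stage of the run. -/
def step (F : Stage S A B → ℝ) (g : Stage S A B) : ℝ :=
  stepExp R.G R.nash R.D R.H R.δ R.T R.opp F g

variable (R) in
/-- The expectation of a function of the stage after `t` rounds of the run. -/
def expAt (s₁ : S) (t : ℕ) (F : Stage S A B → ℝ) : ℝ :=
  stageExp R.G R.nash R.D R.H R.δ R.T R.opp s₁ t F

/-- Optimism once lost is never regained, which lets potentials be frozen at its loss. -/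
theorem Good.of_next {g : Stage S A B} {a : A} {b : B} {s' : S}
    (h : R.Good (R.next g a b s').memory) : R.Good g.memory :=
  fun i j k => (h i j k).trans (Memory.update_Qdown_le ..)

theorem Good.next {g : Stage S A B} {a : A} {b : B} {s' : S} (hg : R.Good g.memory)
    (h : R.c g.state a b ≤ R.newQ g a b s') : R.Good (R.next g a b s').memory := by
  intro i j k
  rw [Run.next, nextStage, Memory.update_Qdown]
  split_ifs with hz
  · obtain ⟨rfl, rfl, rfl⟩ := hz
    exact le_min (hg _ _ _) h
  · exact hg i j k

theorem total_next (F : ℕ → ℝ → S × A × B → ℝ) (g : Stage S A B) (a : A) (b : B) (s' : S) :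
    (R.next g a b s').memory.total F = g.memory.total F +
      (F (g.memory.N g.state a b + 1) (R.newQ g a b s') (g.state, a, b) -
        F (g.memory.N g.state a b) (g.memory.Q g.state a b) (g.state, a, b)) :=
  Memory.total_update ..

theorem step_mono {F F' : Stage S A B → ℝ} {g : Stage S A B}
    (h : ∀ a b s', F (R.next g a b s') ≤ F' (R.next g a b s')) : R.step F g ≤ R.step F' g :=
  stepExp_mono _ _ _ _ _ _ _ h

theorem step_le_of_expect_le {F : Stage S A B → ℝ} {g : Stage S A B} {x : ℝ}
    (h : ∀ a b, R.G.expect (fun s' => F (R.next g a b s')) g.state a b ≤ x) : R.step F g ≤ x :=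
  mix_le _ _ h

theorem expAt_mono {s₁ : S} {t : ℕ} {F F' : Stage S A B → ℝ}
    (h : ∀ g, Reachable R.H t g → F g ≤ F' g) : R.expAt s₁ t F ≤ R.expAt s₁ t F' :=
  Reachable.stageExp_mono R.isNashSolver R.D_nonneg R.one_le_H R.opp s₁ t h

/-- A function that grows by at most `x` in expectation per round. -/
theorem expAt_le_of_step_le {s₁ : S} {t : ℕ} {F : Stage S A B → ℝ} {x : ℝ}
    (h : ∀ k < t, ∀ g, Reachable R.H k g → R.step F g ≤ F g + x) :
    R.expAt s₁ t F ≤ F ⟨[], s₁, Memory.init S A B R.H⟩ + t * x := by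
  induction t with
  | zero => simp [expAt, stageExp]
  | succ t ih =>
    have h1 : R.expAt s₁ (t + 1) F ≤ R.expAt s₁ t fun g => F g + x :=
      expAt_mono (F := R.step F) fun g hg => h t t.lt_succ_self g hg
    have h2 : R.expAt s₁ t (fun g => F g + x) = R.expAt s₁ t F + x := by
      rw [expAt, stageExp_add, stageExp_const, expAt]
    have h3 := ih fun k hk => h k (hk.trans t.lt_succ_self)
    push_cast
    linarith

variable (R) in
open Classical in
/-- The probability that optimism fails is small. -/
theorem expAt_not_good_le (s₁ : S) (t : ℕ) :
    R.expAt s₁ t (fun g => if R.Good g.memory then 0 else 1) ≤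
      t * Real.exp (-Real.log (2 * R.T / R.δ)) := by
  set l := Real.log (2 * R.T / R.δ) with hl
  obtain ⟨φ, φ0, φanti, φinit, φneg, φstep⟩ :=
    exists_potential S R.D_nonneg R.one_le_H R.log_nonneg
  set Ψ : ℕ → ℝ → S × A × B → ℝ := fun k q z => φ k (q - R.c z.1 z.2.1 z.2.2) with hΨ
  set Γ : Stage S A B → ℝ := fun g => if R.Good g.memory then g.memory.total Ψ else Real.exp l
    with hΓ
  have hΨ0 : ∀ m : Memory S A B, 0 ≤ m.total Ψ := fun m => Finset.sum_nonneg fun z _ => φ0 _ _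
  have hΓ0 : Γ ⟨[], s₁, Memory.init S A B R.H⟩ = 0 := by
    rw [hΓ]
    have : R.Good (Memory.init S A B R.H) := fun i j k => R.c_le i j k
    simp only [this, if_true]
    refine Finset.sum_eq_zero fun z _ => φinit _ (sub_nonneg.2 (R.c_le _ _ _))
  have hstep : ∀ k < t, ∀ g, Reachable R.H k g → R.step Γ g ≤ Γ g + 1 := by
    intro k _ g hr
    refine step_le_of_expect_le fun a b => ?_
    by_cases hg : R.Good g.memory
    · set n := g.memory.N g.state a b with hn
      set y := g.memory.Q g.state a b - R.c g.state a b with hy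
      set x : S → ℝ := fun s' => (1 - 1 / R.H) * (R.h s' - R.G.expect R.h g.state a b) with hx
      set ψ : S → ℝ := fun s' => φ (n + 1) ((1 - learningRate R.H (n + 1)) * y +
          learningRate R.H (n + 1) * (x s' + 2 * R.D * Real.sqrt (R.H * l / (n + 1 : ℕ))))
      have hle : ∀ s', Γ (R.next g a b s') ≤ g.memory.total Ψ - φ n y + ψ s' := by
        intro s'
        have h1 : φ (n + 1) (R.newQ g a b s' - R.c g.state a b) ≤ ψ s' :=
          φanti _ (newQ_sub_c_ge hr hg a b s')
        have h2 : (R.next g a b s').memory.total Ψ ≤ g.memory.total Ψ - φ n y + ψ s' := by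
          rw [total_next]
          linarith
        refine le_trans ?_ h2
        simp only [hΓ]
        split_ifs with h3
        · exact le_rfl
        · have h4 : R.newQ g a b s' < R.c g.state a b :=
            not_le.1 fun h => h3 (hg.next h)
          refine (φneg n _ (sub_neg.2 h4)).trans ?_
          have h5 : Ψ ((R.next g a b s').memory.N g.state a b)
              ((R.next g a b s').memory.Q g.state a b) (g.state, a, b) ≤
              (R.next g a b s').memory.total Ψ :=
            Finset.single_le_sum (f := fun z : S × A × B =>
              Ψ ((R.next g a b s').memory.N z.1 z.2.1 z.2.2)
              ((R.next g a b s').memory.Q z.1 z.2.1 z.2.2) z) (fun z _ => φ0 _ _)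
              (Finset.mem_univ (g.state, a, b))
          refine le_trans (le_of_eq ?_) h5
          simp [hΨ, Run.next, nextStage, Memory.update_N, Memory.update_Q, newQ, hn]
      have habs : ∀ s', |x s'| ≤ R.D := by
        intro s'
        have h1 := R.h_mem s'
        have h2 := R.expect_h_mem g.state a b
        simp only [hx]
        rw [abs_mul, abs_of_nonneg R.discount_nonneg]
        have h3 : |R.h s' - R.G.expect R.h g.state a b| ≤ R.D :=
          abs_le.2 ⟨by linarith [h1.1, h2.2], by linarith [h1.2, h2.1]⟩
        exact (mul_le_of_le_one_left (abs_nonneg _) R.discount_le_one).trans h3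
      have hmean : ∑ s', (R.G.P g.state a b).1 s' * x s' = 0 := by
        have : R.G.expect x g.state a b = 0 := by
          simp only [hx]
          rw [Game.expect_mul_left, Game.expect_sub, Game.expect_const, sub_self, mul_zero]
        exact this
      have hfin : R.G.expect ψ g.state a b ≤ φ n y + 1 := φstep _ x habs hmean n y
      refine (R.G.expect_mono hle _ a b).trans ?_
      rw [Game.expect_add, Game.expect_const]
      have : Γ g = g.memory.total Ψ := by simp only [hΓ, hg, if_true]
      rw [this]
      linarith
    · refine R.G.expect_le (fun s' => ?_) _ a b
      have h1 : ¬ R.Good (R.next g a b s').memory := fun h => hg h.of_next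
      simp only [hΓ, hg, h1, if_false]
      linarith
  have h1 := expAt_le_of_step_le (s₁ := s₁) hstep
  rw [hΓ0, zero_add, mul_one] at h1
  -- Markov's inequality: `Γ` is non-negative and equals `exp l` on failure.
  have h2 : R.expAt s₁ t (fun g => if R.Good g.memory then 0 else 1) ≤
      R.expAt s₁ t fun g => Real.exp (-l) * Γ g := by
    refine expAt_mono fun g _ => ?_
    simp only [hΓ]
    split_ifs
    · exact mul_nonneg (Real.exp_pos _).le (hΨ0 _)
    · rw [← Real.exp_add, neg_add_cancel, Real.exp_zero]
  refine h2.trans ?_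
  rw [expAt, stageExp_mul_left, mul_comm]
  exact mul_le_mul_of_nonneg_right h1 (Real.exp_pos _).le

end Run

/-! ### The regret potential. -/

theorem inv_sqrt_succ_le (k : ℕ) :
    Real.sqrt (1 / (k + 1 : ℕ)) ≤ 2 * (Real.sqrt (k + 1 : ℕ) - Real.sqrt k) := by
  have h1 : (Real.sqrt (k + 1 : ℕ)) ^ 2 = k + 1 := by
    rw [Real.sq_sqrt (by positivity)]; push_cast; ring
  have h2 : (Real.sqrt k) ^ 2 = k := Real.sq_sqrt k.cast_nonneg
  have h0 : 0 < Real.sqrt (k + 1 : ℕ) := Real.sqrt_pos.2 (by positivity)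
  rw [Real.sqrt_div zero_le_one, Real.sqrt_one, div_le_iff₀ h0]
  nlinarith [sq_nonneg (Real.sqrt (k + 1 : ℕ) - Real.sqrt k)]

theorem regret_mem {S A B : Type*} [Fintype S] (G : Game S A B) {J : ℝ}
    (hJ : J ∈ Set.Icc (0 : ℝ) 1) (l : List (S × A × B)) :
    regret G J l ∈ Set.Icc (-(l.length : ℝ)) l.length := by
  induction l with
  | nil => simp [regret]
  | cons z l ih =>
    have h := G.r_mem z.1 z.2.1 z.2.2
    have e : regret G J (z :: l) = J - G.r z.1 z.2.1 z.2.2 + regret G J l := by simp [regret]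
    rw [e, List.length_cons]
    push_cast
    constructor
    · linarith [ih.1, hJ.1, h.2]
    · linarith [ih.2, hJ.2, h.1]

namespace Run

variable {S A B : Type*} [Fintype S] [Fintype A] [Fintype B] [Nonempty A] [Nonempty B]
  (R : Run S A B)

/-- The scale of the total bonus. -/
def κ : ℝ := (1 + 1 / R.H) * (4 * R.D * Real.sqrt (R.H * Real.log (2 * R.T / R.δ)))

theorem κ_nonneg : 0 ≤ R.κ := by
  have := R.H_pos
  have := R.D_nonneg
  rw [κ]; positivity

/-- Since `1 / √(k + 1) ≤ 2 (√(k + 1) - √k)`, the bonuses of an entry telescope to at most `κ` times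
the root of its count. -/
theorem bonus_le (k : ℕ) : (1 + 1 / R.H) * bonus R.D R.H R.δ R.T (k + 1) ≤
    R.κ * (Real.sqrt (k + 1 : ℕ) - Real.sqrt k) := by
  have hH := R.H_pos
  have hD := R.D_nonneg
  have hl := R.log_nonneg
  have h1 : Real.sqrt (R.H * Real.log (2 * R.T / R.δ) / (k + 1 : ℕ)) =
      Real.sqrt (R.H * Real.log (2 * R.T / R.δ)) * Real.sqrt (1 / (k + 1 : ℕ)) := by
    rw [← Real.sqrt_mul (by positivity), mul_one_div]
  rw [bonus_eq, h1]
  have h2 := mul_le_mul_of_nonneg_left (inv_sqrt_succ_le k)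
    (show 0 ≤ (1 + 1 / R.H) * (2 * R.D * Real.sqrt (R.H * Real.log (2 * R.T / R.δ))) by positivity)
  rw [κ]
  linarith

/-- The part of the potential that is a sum over the entries. -/
def entry (k : ℕ) (q : ℝ) (z : S × A × B) : ℝ :=
  k * (q - R.c z.1 z.2.1 z.2.2) / R.H + (q - R.c z.1 z.2.1 z.2.2) - R.κ * Real.sqrt k

/-- The potential of the regret analysis. -/
def potential (g : Stage S A B) : ℝ :=
  regret R.G R.J g.rounds - g.rounds.length * (R.D / R.H) - g.memory.Vdown g.state +
    ∑ s, g.memory.Vdown s + g.memory.total R.entry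

/-- The number of entries. -/
def card (_ : Run S A B) : ℝ := (Fintype.card S : ℝ) * Fintype.card A * Fintype.card B

theorem card_nonneg : 0 ≤ R.card := by rw [card]; positivity

theorem sum_const_entries (x : ℝ) : ∑ _z : S × A × B, x = R.card * x := by
  rw [Finset.sum_const, Finset.card_univ, Fintype.card_prod, Fintype.card_prod, nsmul_eq_mul, card]
  push_cast
  ring

variable {R}

/-- Cauchy–Schwarz over the entries, whose counts sum to `t`. -/
theorem total_sqrt_le {t : ℕ} {g : Stage S A B} (hr : Reachable R.H t g) :
    g.memory.total (fun k _ _ => Real.sqrt k) ≤ Real.sqrt (R.card * t) := by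
  have h := sq_sum_le_card_mul_sum_sq (s := (Finset.univ : Finset (S × A × B)))
    (f := fun z => Real.sqrt (g.memory.N z.1 z.2.1 z.2.2))
  simp only [Real.sq_sqrt (Nat.cast_nonneg _)] at h
  refine Real.le_sqrt_of_sq_le (h.trans_eq ?_)
  have h1 := hr.total_visits
  rw [Memory.total] at h1
  rw [h1, Finset.card_univ, Fintype.card_prod, Fintype.card_prod, card]
  push_cast
  ring

variable (R) in
theorem total_entry (m : Memory S A B) : m.total R.entry =
    m.total (fun k q z => k * (q - R.c z.1 z.2.1 z.2.2) / R.H + (q - R.c z.1 z.2.1 z.2.2)) -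
      R.κ * m.total fun k _ _ => Real.sqrt k := by
  simp only [Memory.total, entry, Finset.sum_sub_distrib, Finset.mul_sum]

theorem potential_init_le (s₁ : S) :
    R.potential ⟨[], s₁, Memory.init S A B R.H⟩ ≤
      Fintype.card S * R.H + R.card * (R.H + R.D) := by
  have h1 : (Memory.init S A B R.H).total R.entry ≤ R.card * (R.H + R.D) := by
    rw [← sum_const_entries]
    refine Finset.sum_le_sum fun z _ => ?_
    simp only [entry, Memory.init]
    have := R.neg_D_le_c z.1 z.2.1 z.2.2
    simp
    linarith
  have h2 := R.H_pos
  simp only [potential, regret, Memory.init] at h1 ⊢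
  simp
  linarith

/-- The potential is bounded below in terms of the number of rounds. -/
theorem neg_le_potential {t : ℕ} {g : Stage S A B} (hr : Reachable R.H t g) (ht : t ≤ R.T) :
    -(2 * R.T + R.T * (R.D / R.H) + R.κ * Real.sqrt (R.card * R.T) + R.H + R.card * R.H) ≤
      R.potential g := by
  have hH := R.H_pos
  have htT : (t : ℝ) ≤ R.T := by exact_mod_cast ht
  have h1 := (regret_mem R.G R.J_mem g.rounds).1
  rw [hr.length_eq] at h1
  have h2 : (t : ℝ) * (R.D / R.H) ≤ R.T * (R.D / R.H) :=
    mul_le_mul_of_nonneg_right htT (div_nonneg R.D_nonneg hH.le)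
  have h3 := hr.Vdown_le g.state
  have h4 : 0 ≤ ∑ s, g.memory.Vdown s := Finset.sum_nonneg fun s _ => hr.Vdown_nonneg s
  have h5 : R.κ * g.memory.total (fun k _ _ => Real.sqrt k) ≤ R.κ * Real.sqrt (R.card * R.T) :=
    mul_le_mul_of_nonneg_left ((total_sqrt_le hr).trans
      (Real.sqrt_le_sqrt (mul_le_mul_of_nonneg_left htT R.card_nonneg))) R.κ_nonneg
  have h6 : -(t : ℝ) - R.card * R.H ≤ g.memory.total
      (fun k q z => k * (q - R.c z.1 z.2.1 z.2.2) / R.H + (q - R.c z.1 z.2.1 z.2.2)) := by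
    have h7 := hr.total_visits
    rw [Memory.total] at h7
    rw [← h7, ← sum_const_entries, ← Finset.sum_neg_distrib, ← Finset.sum_sub_distrib]
    refine Finset.sum_le_sum fun z _ => ?_
    -- Optimism is not assumed here, only `Q ≥ 0` and `c ≤ H`; under the weight `k / H` this costs
    -- at most one per visit.
    have h8 : -R.H ≤ g.memory.Q z.1 z.2.1 z.2.2 - R.c z.1 z.2.1 z.2.2 := by
      linarith [R.c_le z.1 z.2.1 z.2.2, hr.Qdown_nonneg z.1 z.2.1 z.2.2,
        hr.Qdown_le_Q z.1 z.2.1 z.2.2]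
    have h9 : -(g.memory.N z.1 z.2.1 z.2.2 : ℝ) ≤ g.memory.N z.1 z.2.1 z.2.2 *
        (g.memory.Q z.1 z.2.1 z.2.2 - R.c z.1 z.2.1 z.2.2) / R.H := by
      rw [le_div_iff₀ hH]
      nlinarith [mul_le_mul_of_nonneg_left h8
        (Nat.cast_nonneg (α := ℝ) (g.memory.N z.1 z.2.1 z.2.2))]
    linarith
  rw [potential, hr.length_eq, total_entry]
  linarith

/-- While the estimators are optimistic, the potential bounds the regret. -/
theorem regret_le_potential {t : ℕ} {g : Stage S A B} (hr : Reachable R.H t g)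
    (hg : R.Good g.memory) :
    regret R.G R.J g.rounds ≤ R.potential g + t * (R.D / R.H) +
      R.κ * Real.sqrt (R.card * t) + R.H := by
  have hH := R.H_pos
  have h3 := hr.Vdown_le g.state
  have h4 : 0 ≤ ∑ s, g.memory.Vdown s := Finset.sum_nonneg fun s _ => hr.Vdown_nonneg s
  have h5 : R.κ * g.memory.total (fun k _ _ => Real.sqrt k) ≤ R.κ * Real.sqrt (R.card * t) :=
    mul_le_mul_of_nonneg_left (total_sqrt_le hr) R.κ_nonneg
  have h6 : 0 ≤ g.memory.total
      (fun k q z => k * (q - R.c z.1 z.2.1 z.2.2) / R.H + (q - R.c z.1 z.2.1 z.2.2)) := by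
    refine Finset.sum_nonneg fun z _ => ?_
    have h8 : 0 ≤ g.memory.Q z.1 z.2.1 z.2.2 - R.c z.1 z.2.1 z.2.2 :=
      sub_nonneg.2 ((hg z.1 z.2.1 z.2.2).trans (hr.Qdown_le_Q z.1 z.2.1 z.2.2))
    positivity
  rw [potential, hr.length_eq, total_entry]
  linarith

variable [DecidableEq S] [DecidableEq A] [DecidableEq B]

/-- The increment of the potential, in terms of the next state. -/
theorem potential_next_le {t : ℕ} {g : Stage S A B} (hr : Reachable R.H t g)
    (hg : R.Good g.memory) (a : A) (b : B) (s' : S) :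
    R.potential (R.next g a b s') ≤ R.potential g + g.memory.Vdown g.state -
      g.memory.Q g.state a b + (R.J - R.D / R.H - R.w s' +
        (1 - 1 / R.H ^ 2) * (R.w s' - R.G.expect R.w g.state a b) +
        (1 - 1 / R.H) * R.G.expect R.w g.state a b) := by
  have hH := R.H_pos
  have hr' : Reachable R.H (t + 1) (R.next g a b s') :=
    hr.next R.isNashSolver R.D_nonneg R.one_le_H a b s'
  -- The value at the new state may just have been updated. Both sums omit it, so monotonicity in
  -- time trades its new value for the old one, which enters the target.
  have hV : ∑ s, (R.next g a b s').memory.Vdown s - (R.next g a b s').memory.Vdown s' ≤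
      ∑ s, g.memory.Vdown s - g.memory.Vdown s' := by
    rw [← Finset.add_sum_erase _ _ (Finset.mem_univ s'),
      ← Finset.add_sum_erase (f := g.memory.Vdown) _ (Finset.mem_univ s'),
      add_sub_cancel_left, add_sub_cancel_left]
    exact Finset.sum_le_sum fun s _ => hr'.consistent.Vdown_le hr.consistent
      fun a b => Memory.update_Qdown_le ..
  have hstate : (R.next g a b s').state = s' := rfl
  have hrounds : regret R.G R.J (R.next g a b s').rounds =
      R.J - R.G.r g.state a b + regret R.G R.J g.rounds := by
    simp [Run.next, nextStage, regret]
  have hw := hg.w_le_Vdown hr.consistent s'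
  have hβ := R.bonus_le (g.memory.N g.state a b)
  have hQ := newQ_eq g a b s' (R := R)
  rw [potential, potential, total_next, hr'.length_eq, hr.length_eq, hstate, hrounds]
  simp only [entry, c]
  set k : ℝ := (g.memory.N g.state a b : ℝ) with hk
  set q := R.newQ g a b s'
  set y := g.memory.Q g.state a b
  set E := R.G.expect R.w g.state a b
  set β := bonus R.D R.H R.δ R.T (g.memory.N g.state a b + 1)
  set V := g.memory.Vdown s'
  set x := R.G.r g.state a b
  -- The learning rate makes the weight `1 + k / H` pass to the next count with the old value
  -- keeping weight `k / H`; the loss of one unit produces the term `-y`.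
  have hQ' : (k + 1) * q / R.H + q = k * y / R.H +
      (1 + 1 / R.H) * (x + (1 - 1 / R.H) * V + β) := by
    field_simp
    field_simp at hQ
    linarith
  -- The excess `V - w ≥ 0` enters with `(1 + 1/H)(1 - 1/H) < 1`, so it is absorbed by `-V`. Only
  -- `w` at the next state remains, and its fluctuation averages out.
  have hVw : (1 - 1 / R.H ^ 2) * (V - R.w s') ≤ V - R.w s' :=
    mul_le_of_le_one_left (sub_nonneg.2 hw) (sub_le_self _ (by positivity))
  push_cast at hβ ⊢
  have e1 : ((k + 1) * (q - (x + (1 - 1 / R.H) * E)) / R.H + (q - (x + (1 - 1 / R.H) * E))) -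
      (k * (y - (x + (1 - 1 / R.H) * E)) / R.H + (y - (x + (1 - 1 / R.H) * E))) =
      (1 - 1 / R.H ^ 2) * (V - E) + (1 + 1 / R.H) * β - (y - (x + (1 - 1 / R.H) * E)) := by
    have : ((k + 1) * q / R.H + q) - k * y / R.H -
      (1 + 1 / R.H) * (x + (1 - 1 / R.H) * V + β) = 0 := by rw [hQ']; ring
    linear_combination this
  linarith

/-- While the estimators are optimistic, the potential does not grow in expectation. -/
theorem step_potential_le {t : ℕ} {g : Stage S A B} (hr : Reachable R.H t g)
    (hg : R.Good g.memory) : R.step R.potential g ≤ R.potential g := by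
  have hH := R.H_pos
  have h1 : ∀ a b, R.G.expect (fun s' => R.potential (R.next g a b s')) g.state a b ≤
      R.potential g + g.memory.Vdown g.state - g.memory.Qdown g.state a b := by
    intro a b
    refine (R.G.expect_mono (fun s' => potential_next_le hr hg a b s') _ a b).trans ?_
    simp only [Game.expect_add, Game.expect_sub, Game.expect_mul_left, Game.expect_const]
    have h2 := hr.Qdown_le_Q g.state a b
    -- Since `w ≥ H J - D`, the rate `1 / H` recovers `J` up to `D / H` per round.
    have h3 : R.J - R.D / R.H ≤ 1 / R.H * R.G.expect R.w g.state a b := by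
      have h4 : -R.D / R.H ≤ R.G.expect R.h g.state a b / R.H :=
        div_le_div_of_nonneg_right (R.expect_h_mem g.state a b).1 hH.le
      rw [neg_div] at h4
      have h5 : 1 / R.H * R.G.expect R.w g.state a b =
          R.J + R.G.expect R.h g.state a b / R.H := by
        rw [expect_w]; field_simp
      linarith
    have h6 : R.G.expect (fun s' => R.w s') g.state a b = R.G.expect R.w g.state a b := rfl
    rw [h6]
    linarith
  refine (mix_mono _ _ h1).trans ?_
  rw [mix_sub _ _ (fun _ _ => R.potential g + g.memory.Vdown g.state), mix_const]
  obtain ⟨q, hq, hv⟩ := hr.consistent g.state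
  -- The current policy secures `Vdown` against any mixed action of the opponent.
  have := hq.2 (R.opp g.rounds g.state)
  linarith

variable (R) in
open Classical in
/-- The regret bound, for arbitrary parameters. -/
theorem expAt_regret_le (s₁ : S) :
    R.expAt s₁ R.T (fun g => regret R.G R.J g.rounds) ≤
      R.T * (R.D / R.H) + R.κ * Real.sqrt (R.card * R.T) +
      (R.H + Fintype.card S * R.H + R.card * (R.H + R.D)) +
      (3 * R.T + R.T * (R.D / R.H) + R.κ * Real.sqrt (R.card * R.T) + R.H + R.card * R.H) *
        (R.T * Real.exp (-Real.log (2 * R.T / R.δ))) := by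
  have hH := R.H_pos
  have hT : (0 : ℝ) ≤ R.T := R.T.cast_nonneg
  have hD : 0 ≤ R.T * (R.D / R.H) := mul_nonneg hT (div_nonneg R.D_nonneg hH.le)
  have hκ : 0 ≤ R.κ * Real.sqrt (R.card * R.T) := mul_nonneg R.κ_nonneg (Real.sqrt_nonneg _)
  have hn : 0 ≤ R.card * R.H := mul_nonneg R.card_nonneg hH.le
  set C := 2 * R.T + R.T * (R.D / R.H) + R.κ * Real.sqrt (R.card * R.T) + R.H + R.card * R.H
    with hC
  -- By `neg_le_potential` the shift by `C` makes the potential non-negative up to time `T`, so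
  -- setting it to zero when optimism fails cannot increase the expectation.
  set Y : Stage S A B → ℝ := fun g => if R.Good g.memory then R.potential g + C else 0 with hY
  have hstep : ∀ k < R.T, ∀ g, Reachable R.H k g → R.step Y g ≤ Y g + 0 := by
    intro k hk g hr
    rw [add_zero]
    by_cases hg : R.Good g.memory
    · have h1 : R.step Y g ≤ R.step (fun g => R.potential g + C) g := by
        refine step_mono fun a b s' => ?_
        simp only [hY]
        split_ifs
        · exact le_rfl
        · have := neg_le_potential (R := R)
            (hr.next (G := R.G) (nash := R.nash) (δ := R.δ) (T := R.T) R.isNashSolver R.D_nonneg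
              R.one_le_H a b s') hk
          rw [Run.next]
          linarith
      have h2 : R.step (fun g => R.potential g + C) g = R.step R.potential g + C := by
        rw [step, stepExp_add, stepExp_const, step]
      have h3 : Y g = R.potential g + C := by simp only [hY, hg, if_true]
      linarith [step_potential_le hr hg]
    · refine step_le_of_expect_le fun a b => R.G.expect_le (fun s' => ?_) _ a b
      have h1 : ¬ R.Good (R.next g a b s').memory := fun h => hg h.of_next
      simp only [hY, hg, h1, if_false, le_refl]
  have h1 := expAt_le_of_step_le (s₁ := s₁) hstep
  have hY0 : Y ⟨[], s₁, Memory.init S A B R.H⟩ = R.potential ⟨[], s₁, Memory.init S A B R.H⟩ + C := by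
    have : R.Good (Memory.init S A B R.H) := fun i j k => R.c_le i j k
    simp only [hY, this, if_true]
  rw [mul_zero, add_zero, hY0] at h1
  have h2 := R.expAt_not_good_le s₁ R.T
  set bad : Stage S A B → ℝ := fun g => if R.Good g.memory then 0 else 1 with hbad
  set W := R.T * (R.D / R.H) + R.κ * Real.sqrt (R.card * R.T) + R.H - C with hW
  -- On failure the regret is at most `T`; the further weight `C` cancels the `-C` contained in `W`.
  have h3 : R.expAt s₁ R.T (fun g => regret R.G R.J g.rounds) ≤
      R.expAt s₁ R.T (fun g => Y g + (W + (R.T + C) * bad g)) := by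
    refine expAt_mono fun g hr => ?_
    by_cases hg : R.Good g.memory
    · have := regret_le_potential hr hg
      simp only [hY, hbad, hg, if_true]
      linarith
    · have := (regret_mem R.G R.J_mem g.rounds).2
      rw [hr.length_eq] at this
      simp only [hY, hbad, hg, if_false]
      linarith
  have h4 : R.expAt s₁ R.T (fun g => Y g + (W + (R.T + C) * bad g)) =
      R.expAt s₁ R.T Y + (W + (R.T + C) * R.expAt s₁ R.T bad) := by
    simp only [expAt, stageExp_add, stageExp_const, stageExp_mul_left]
  have h5 := mul_le_mul_of_nonneg_left h2 (show 0 ≤ R.T + C by linarith)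
  have h6 := potential_init_le (R := R) s₁
  have h7 : 3 * R.T + R.T * (R.D / R.H) + R.κ * Real.sqrt (R.card * R.T) + R.H + R.card * R.H =
      R.T + C := by rw [hC]; ring
  rw [h7]
  linarith

end Run

/-! ### Orders of growth. -/

section Asymptotics

open Filter Topology Asymptotics

theorem tendsto_const_mul_log_div (n : ℝ) :
    Tendsto (fun T : ℕ => n * Real.log (2 * (T : ℝ) ^ 2) / T) atTop (𝓝 0) := by
  have h1 : Tendsto (fun T : ℕ => Real.log T / T) atTop (𝓝 0) :=
    Real.isLittleO_log_id_atTop.tendsto_div_nhds_zero.comp tendsto_natCast_atTop_atTop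
  have h2 : Tendsto (fun T : ℕ => n * (Real.log 2 / T + 2 * (Real.log T / T))) atTop
      (𝓝 (n * (0 + 2 * 0))) :=
    ((tendsto_const_div_atTop_nhds_zero_nat _).add (h1.const_mul 2)).const_mul n
  rw [mul_zero, add_zero, mul_zero] at h2
  refine h2.congr' ?_
  filter_upwards [eventually_gt_atTop 0] with T hT
  have : (T : ℝ) ≠ 0 := by positivity
  rw [Real.log_mul two_ne_zero (by positivity), Real.log_pow]
  push_cast
  ring

theorem isLittleO_natCast_rpow {p q : ℝ} (h : p < q) :
    (fun T : ℕ => (T : ℝ) ^ p) =o[atTop] fun T : ℕ => (T : ℝ) ^ q := by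
  refine isLittleO_iff_exists_eq_mul.2 ⟨_,
    (tendsto_rpow_neg_atTop (sub_pos.2 h)).comp tendsto_natCast_atTop_atTop, ?_⟩
  filter_upwards [eventually_gt_atTop 0] with T hT
  have hT' : (0 : ℝ) < T := by positivity
  rw [Pi.mul_apply, Function.comp_apply, ← Real.rpow_add hT']
  congr 1
  ring

theorem isLittleO_lower_order (a b : ℝ) {q : ℝ} (hq : 1 / 3 < q) :
    (fun T : ℕ => a * (T : ℝ) ^ (1 / 3 : ℝ) + b) =o[atTop] fun T : ℕ => (T : ℝ) ^ q := by
  refine ((isLittleO_natCast_rpow hq).const_mul_left a).add ?_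
  have h := (isLittleO_natCast_rpow (show (0 : ℝ) < q by linarith)).const_mul_left b
  simpa using h

/-- The left side is `d * (L / T) ^ (1/3) * T`, and `L / T` tends to zero. -/
theorem isLittleO_rpow_mul_rpow {L : ℕ → ℝ} (h0 : ∀ T, 0 ≤ L T)
    (hL : Tendsto (fun T : ℕ => L T / T) atTop (𝓝 0)) (d : ℝ) :
    (fun T : ℕ => d * L T ^ (1 / 3 : ℝ) * (T : ℝ) ^ (2 / 3 : ℝ)) =o[atTop]
      fun T : ℕ => (T : ℝ) := by
  have h1 : Tendsto (fun T : ℕ => d * (L T / T) ^ (1 / 3 : ℝ)) atTop (𝓝 0) := by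
    have := (hL.rpow_const (p := 1 / 3) (Or.inr (by norm_num))).const_mul d
    rwa [Real.zero_rpow (by norm_num), mul_zero] at this
  refine isLittleO_iff_exists_eq_mul.2 ⟨_, h1, ?_⟩
  filter_upwards [eventually_gt_atTop 0] with T hT
  have hT' : (0 : ℝ) < T := by positivity
  have e : (T : ℝ) = (T : ℝ) ^ (1 / 3 : ℝ) * (T : ℝ) ^ (2 / 3 : ℝ) := by
    rw [← Real.rpow_add hT']; norm_num
  have h3 : (T : ℝ) ^ (1 / 3 : ℝ) ≠ 0 := (Real.rpow_pos_of_pos hT' _).ne'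
  calc d * L T ^ (1 / 3 : ℝ) * (T : ℝ) ^ (2 / 3 : ℝ)
      = d * (L T ^ (1 / 3 : ℝ) / (T : ℝ) ^ (1 / 3 : ℝ)) *
        ((T : ℝ) ^ (1 / 3 : ℝ) * (T : ℝ) ^ (2 / 3 : ℝ)) := by field_simp
    _ = _ := by rw [← e, Pi.mul_apply, Real.div_rpow (h0 T) hT'.le]

end Asymptotics

end DONQ

/-! ### The bound for the prescribed parameters. -/

theorem mainTheorem4 {S A B : Type*} [Fintype S] [Fintype A] [Fintype B]
    [Nonempty S] [Nonempty A] [Nonempty B] [DecidableEq S] [DecidableEq A] [DecidableEq B]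
    (D : ℝ) (hD : 0 ≤ D) (L H : ℕ → ℝ)
    (hL : ∀ T : ℕ, L T =
      (Fintype.card S : ℝ) * Fintype.card A * Fintype.card B * Real.log (2 * (T : ℝ) ^ 2))
    (hH : ∀ T : ℕ, H T = ((T : ℝ) / L T) ^ (1 / 3 : ℝ)) :
    ∃ (f : ℕ → ℝ) (T₀ : ℕ),
      f =o[Filter.atTop] (fun T : ℕ => (T : ℝ) ^ (2 / 3 : ℝ)) ∧
      (fun T : ℕ => 13 * D * L T ^ (1 / 3 : ℝ) * (T : ℝ) ^ (2 / 3 : ℝ) + f T)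
        =o[Filter.atTop] (fun T : ℕ => (T : ℝ)) ∧
      ∀ G : DONQ.Game S A B, G.diameter ≤ ENNReal.ofReal D →
        ∃ J : ℝ, G.IsValue J ∧
          ∀ nash : (A → B → ℝ) → DONQ.Dist A × DONQ.Dist B, DONQ.IsNashSolver nash →
          ∀ (opp : DONQ.Opponent S A B) (s₁ : S) (T : ℕ), T₀ ≤ T →
            DONQ.expectedRegret G J nash D (H T) (1 / (T : ℝ)) T opp s₁
              ≤ 13 * D * L T ^ (1 / 3 : ℝ) * (T : ℝ) ^ (2 / 3 : ℝ) + f T := by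
  set n : ℝ := (Fintype.card S : ℝ) * Fintype.card A * Fintype.card B with hn
  have hn1 : 1 ≤ n := by
    have h1 : (1 : ℝ) ≤ Fintype.card S := by exact_mod_cast Fintype.card_pos
    have h2 : (1 : ℝ) ≤ Fintype.card A := by exact_mod_cast Fintype.card_pos
    have h3 : (1 : ℝ) ≤ Fintype.card B := by exact_mod_cast Fintype.card_pos
    exact one_le_mul_of_one_le_of_one_le (one_le_mul_of_one_le_of_one_le h1 h2) h3
  have hlim : Filter.Tendsto (fun T : ℕ => L T / T) Filter.atTop (nhds 0) := by
    simp only [hL]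
    exact DONQ.tendsto_const_mul_log_div n
  have hL0 : ∀ T, 0 ≤ L T := fun T => by
    rw [hL]
    refine mul_nonneg (by linarith) ?_
    rcases Nat.eq_zero_or_pos T with rfl | hT
    · simp
    · have : (1 : ℝ) ≤ T := by exact_mod_cast hT
      exact Real.log_nonneg (by nlinarith)
  obtain ⟨T₁, hT₁⟩ := Filter.eventually_atTop.1 (hlim.eventually (ge_mem_nhds one_pos))
  -- The error collects the boundary terms, using `H ≤ T ^ (1/3)`, and a constant for the failure
  -- event. Beyond `T₁`, `L T ≤ T`, which gives `H ≥ 1`; `T ≥ 2` makes the logarithm at least one.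
  refine ⟨fun T => (1 + Fintype.card S + n) * (T : ℝ) ^ (1 / 3 : ℝ) + (n * D + (4 + 9 * D + n)),
    max T₁ 2, DONQ.isLittleO_lower_order _ _ (by norm_num), ?_, fun G hG => ?_⟩
  · refine (DONQ.isLittleO_rpow_mul_rpow hL0 hlim (13 * D)).add ?_
    simpa using DONQ.isLittleO_lower_order (1 + Fintype.card S + n) (n * D + (4 + 9 * D + n))
      (q := 1) (by norm_num)
  obtain ⟨J, h, hJ, hh, hopt⟩ := G.exists_optimality hD hG
  refine ⟨J, G.isValue_of_optimality hopt, fun nash hnash opp s₁ T hT => ?_⟩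
  have hT2 : (2 : ℝ) ≤ T := by exact_mod_cast (le_max_right _ _).trans hT
  have hT0 : (0 : ℝ) < T := by linarith
  have hl : Real.log (2 * T / (1 / (T : ℝ))) = Real.log (2 * (T : ℝ) ^ 2) := by
    congr 1; field_simp
  set l := Real.log (2 * (T : ℝ) ^ 2) with hldef
  have hl1 : 1 ≤ l := by
    rw [hldef, Real.le_log_iff_exp_le (by positivity)]
    nlinarith [Real.exp_one_lt_d9]
  have hLT : L T = n * l := hL T
  have hL1 : 1 ≤ L T := by rw [hLT]; exact one_le_mul_of_one_le_of_one_le hn1 hl1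
  have hLleT : L T ≤ T := (div_le_one hT0).1 (hT₁ T ((le_max_left _ _).trans hT))
  -- In terms of the cube roots `u` of `T` and `v` of `L`, `H = u / v` and the target rate is `v * u
  -- ^ 2`; the rest is polynomial algebra.
  set u := (T : ℝ) ^ (1 / 3 : ℝ) with hu
  set v := L T ^ (1 / 3 : ℝ) with hv
  have hu3 : u ^ 3 = T := by
    rw [hu, ← Real.rpow_natCast, ← Real.rpow_mul hT0.le]; norm_num
  have hv3 : v ^ 3 = L T := by
    rw [hv, ← Real.rpow_natCast, ← Real.rpow_mul (hL0 T)]; norm_num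
  have hu2 : (T : ℝ) ^ (2 / 3 : ℝ) = u ^ 2 := by
    rw [hu, ← Real.rpow_natCast, ← Real.rpow_mul hT0.le]; norm_num
  have hv1 : 1 ≤ v := Real.one_le_rpow hL1 (by norm_num)
  have huv : v ≤ u := Real.rpow_le_rpow (hL0 T) hLleT (by norm_num)
  have hHuv : H T = u / v := by rw [hH, Real.div_rpow hT0.le (hL0 T)]
  have hH1 : 1 ≤ H T := by rw [hHuv, one_le_div (by linarith)]; exact huv
  have hHu : H T ≤ u := by rw [hHuv]; exact div_le_self (by linarith) hv1
  have huT : u ≤ T := by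
    rw [← hu3]; exact le_self_pow₀ (hv1.trans huv) (by norm_num)
  let R : DONQ.Run S A B :=
    { G := G, nash := nash, D := D, H := H T, δ := 1 / T, T := T, opp := opp, J := J, h := h
      isNashSolver := hnash, D_nonneg := hD, one_le_H := hH1
      log_nonneg := by rw [hl]; linarith
      J_mem := hJ, h_mem := hh, optimality := hopt }
  have hreg := R.expAt_regret_le s₁
  have hX : (T : ℝ) * (D / H T) = D * (v * u ^ 2) := by
    rw [hHuv, ← hu3]; field_simp
  have hXT : v * u ^ 2 ≤ T := by
    rw [← hu3]; nlinarith [sq_nonneg u]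
  have hκ : R.κ * Real.sqrt (R.card * T) ≤ 8 * D * (v * u ^ 2) := by
    have e1 : Real.sqrt (H T * l) * Real.sqrt (n * T) = v * u ^ 2 := by
      rw [← Real.sqrt_mul (by positivity), show H T * l * (n * T) = H T * (n * l) * T by ring,
        ← hLT, hHuv, ← hv3, ← hu3, show u / v * v ^ 3 * u ^ 3 = (v * u ^ 2) ^ 2 by field_simp,
        Real.sqrt_sq (by positivity)]
    have e2 : 1 / H T ≤ 1 := (div_le_one (by linarith)).2 hH1
    calc R.κ * Real.sqrt (R.card * T)
        = (1 + 1 / H T) * (4 * D * (Real.sqrt (H T * l) * Real.sqrt (n * T))) := by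
          rw [DONQ.Run.κ, DONQ.Run.card]
          simp only [R, hl]
          ring
      _ = (1 + 1 / H T) * (4 * D * (v * u ^ 2)) := by rw [e1]
      _ ≤ 2 * (4 * D * (v * u ^ 2)) := by gcongr; linarith
      _ = _ := by ring
  -- With `δ = 1 / T` the failure probability is at most `1 / (2T)`, so a loss of order `T` on
  -- failure costs a constant.
  have hexp : (T : ℝ) * Real.exp (-Real.log (2 * T / (1 / (T : ℝ)))) = 1 / (2 * T) := by
    rw [hl, Real.exp_neg, Real.exp_log (by positivity)]; field_simp
  have hmain : DONQ.expectedRegret G J nash D (H T) (1 / (T : ℝ)) T opp s₁ ≤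
      T * (D / H T) + R.κ * Real.sqrt (R.card * T) +
      (H T + Fintype.card S * H T + n * (H T + D)) +
      (3 * T + T * (D / H T) + R.κ * Real.sqrt (R.card * T) + H T + n * H T) * (1 / (2 * T)) := by
    rw [DONQ.expectedRegret_eq, ← hexp]
    exact hreg
  refine hmain.trans ?_
  have hlast : (3 * T + T * (D / H T) + R.κ * Real.sqrt (R.card * T) + H T + n * H T) *
      (1 / (2 * T)) ≤ 4 + 9 * D + n := by
    rw [mul_one_div, div_le_iff₀ (by positivity), hX]
    have e1 : D * (v * u ^ 2) ≤ D * T := mul_le_mul_of_nonneg_left hXT hD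
    have e2 : n * H T ≤ n * T := mul_le_mul_of_nonneg_left (hHu.trans huT) (by linarith)
    have e3 : 0 ≤ (4 + 9 * D + n) * T := by positivity
    linarith
  have hmid : H T + Fintype.card S * H T + n * (H T + D) ≤
      (1 + Fintype.card S + n) * u + n * D := by
    have : (1 + Fintype.card S + n) * H T ≤ (1 + Fintype.card S + n) * u :=
      mul_le_mul_of_nonneg_left hHu (by positivity)
    linarith
  -- The leading coefficients add up to `9 D`; non-negativity relaxes this to `13 D`.
  have hpos : 0 ≤ D * (v * u ^ 2) := by positivity
  rw [hu2]
  linarith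

end
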